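/- Let $n\ge 1$, let $\mathbf B^n$ be the open unit ball of $\mathbb R^n$ (Euclidean norm), let $H$ be a real Hilbert space (a complex Hilbert space is regarded as a real one with inner product $\operatorname{Re}\langle\cdot,\cdot\rangle$) and let $\mathbb B$ be the open unit ball of $H$. For $m\ge 1$ put $$C_m=\frac{m!\,\Bigl(1+m-(m-2)\;{}_2F_1\bigl[\tfrac12,1;\tfrac{3+m}2;-1\bigr]\Bigr)}{2^{3m/2}\,\Gamma\bigl(\tfrac{1+m}2\bigr)\,\Gamma\bigl(\tfrac{3+m}2\bigr)},\qquad {}_2F_1[\alpha,\beta;\gamma;x]=\sum_{k\ge 0}\frac{(\alpha)_k(\beta)_k}{(\gamma)_k}\frac{x^k}{k!},$$ where $(\alpha)_k=\alpha(\alpha+1)\cdots(\alpha+k-1)$ (the series converges absolutely at $x=-1$ for these parameters). Let $f:\mathbf B^n\to\mathbb B$ be harmonic, that is, of class $C^2$ with $\sum_{i=1}^n\partial^2 f/\partial x_i^2=0$ on $\mathbf B^n$. Suppose that $f(0)=0$ and that $f$ extends continuously to a point $a$ with $|a|=1$, with $f(a)=b$ and $|b|=1$. Write $D_rf(ra)=\frac{d}{dt}f(ta)\big|_{t=r}$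 for $0\le r<1$. Then: (1) $\displaystyle\limsup_{r\to1^-}|D_rf(ra)|\ge C_n$ (the upper limit is taken in $[0,\infty]$). (2) Suppose in addition that the extension of $f$ to $\mathbf B^n\cup\{a\}$ is differentiable at $a$, that is, there is a bounded linear map $Df(a):\mathbb R^n\to H$ with $f(x)=b+Df(a)(x-a)+o(|x-a|)$ as $x\to a$, $x\in\mathbf B^n$. Then there is a real number $\lambda>0$ with $Df(a)^*b=\lambda a$, and $\lambda\ge C_n$. (3) If $n=2$ in (2), then $\lambda\ge\frac2\pi$. This bound is sharp: for all $a\in\mathbb R^2$ and $b\in H$ with $|a|=|b|=1$ there is a harmonic $f:\mathbf B^2\to\mathbb B$ satisfying all the hypotheses, including differentiability at $a$, for which $Df(a)^*b=\frac2\pi a$. -/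

import Mathlib

open Metric Filter Topology InnerProductSpace
open scoped Nat

/-- The constant
`C_m = m! (1 + m - (m - 2) ₂F₁[1/2, 1; (3+m)/2; -1]) / (2^(3m/2) Γ((1+m)/2) Γ((3+m)/2))`,
where `₂F₁` is the Gaussian hypergeometric series (it converges absolutely at `-1` here). -/
noncomputable def kalajConstant (m : ℕ) : ℝ :=
  ((m ! : ℕ) : ℝ) *
      (1 + (m : ℝ) -
        ((m : ℝ) - 2) * ordinaryHypergeometric (1 / 2 : ℝ) (1 : ℝ) ((3 + (m : ℝ)) / 2) (-1 : ℝ)) /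
    ((2 : ℝ) ^ (3 * (m : ℝ) / 2) * Real.Gamma ((1 + (m : ℝ)) / 2) *
      Real.Gamma ((3 + (m : ℝ)) / 2))

/-- `f` is a harmonic map of the open unit ball of `ℝⁿ` into the open unit ball of `H`, it fixes
the origin, and (with the value `b` at `a`) it extends continuously to the boundary point `a`,
where `‖b‖ = 1`. Only the values of `f` on the open ball and at `a` matter. -/
structure IsBoundarySchwarzMap {n : ℕ} {H : Type*} [NormedAddCommGroup H] [InnerProductSpace ℝ H]
    (f : EuclideanSpace ℝ (Fin n) → H) (a : EuclideanSpace ℝ (Fin n)) (b : H) : Prop where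
  harmonic : HarmonicOnNhd f (ball 0 1)
  mapsTo : Set.MapsTo f (ball 0 1) (ball 0 1)
  map_zero : f 0 = 0
  norm_point : ‖a‖ = 1
  norm_value : ‖b‖ = 1
  map_point : f a = b
  continuous_at_point : ContinuousWithinAt f (ball 0 1) a

/-!
The argument concerns the real function `w = 1 - ⟪b, f⟫`. It is harmonic in the ball, takes values
in `[0, 2]`, and equals `1` at the origin and `0` at `a`; the task is to bound it from below on
the radius ending at `a`.

*Poisson formula.* Green's second identity on spheres (`integral_sphere_wronskian_eq_zero`) follows
by testing with radial functions and integrating by parts. It shows that for harmonic `u` and `v`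
the integral of `u (s ζ) v (t ζ)` over the unit sphere depends on `s * t` only
(`integral_sphere_dilation_eq`). The case `v = 1` is the mean value property. The case where `v` is
the Poisson kernel with pole `a` gives, on moving `t` to `1`, the Poisson formula at the points of
the ray through `a` (`integral_sphere_mul_ballPoissonKernel`); no boundary values of `u` are needed.

*Extremal density.* The kernel at `ρ • a` is smaller on the hemisphere opposite to `a` than on the
other one. Among densities with values in `[0, 2]` and mean `1`, its integral is therefore minimal
for the density `2` on that hemisphere, and there the kernel is at least
`(1 - ρ ^ 2) ‖ζ - a‖ ^ (-n)` (`mul_integral_oppositeHemisphere_le`).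

*The constant.* The integral of `‖ζ - a‖ ^ (-n)` over the hemisphere is carried to `ℝ^(n - 1)` by
the gnomonic projection (`integral_oppositeHemisphere_eq_integral_gnomonicDensity`). Polar
coordinates and a substitution turn it into an integral over `[0, 1]`, a contiguous relation
(`mul_integral_add_mul_integral_eq`) into Euler's integral for the hypergeometric series in the
constant (`ordinaryHypergeometric_half_one_neg_one`). The result is
`four_mul_integral_oppositeHemisphere`, and hence the estimate
`(1 - ρ ^ 2) / 2 * C_n ≤ 1 - ⟪b, f (ρ • a)⟫` (`IsBoundarySchwarzMap.one_sub_inner_ge`).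

*Consequences.* The bound for the upper limit follows from the mean value theorem on `[r, 1]`. If
`f` is differentiable at `a`, then `⟪b, f⟫` has a boundary maximum there, which makes its gradient
`Df(a)* b` a multiple of the normal `a`; the multiple is the radial derivative, bounded below by
the estimate. In the plane the constant is `2 / π`, and it is attained by
`z ↦ (2 / π) arg ((1 + i z) / (1 - i z)) • b` in coordinates with `a = 1`, the Poisson integral
of `b` on the half circle around `a` and of `-b` on the opposite one.
-/

open MeasureTheory Module

/-! ### Green's second identity with a radial weight -/

section Green

variable {E : Type*} [NormedAddCommGroup E] [InnerProductSpace ℝ E] [FiniteDimensional ℝ E]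

theorem laplacian_eq_sum_fderiv {ι : Type*} [Fintype ι] (e : OrthonormalBasis ι ℝ E)
    {f : E → ℝ} {x : E} (hf : ContDiffAt ℝ 2 f x) :
    Laplacian.laplacian f x = ∑ i, fderiv ℝ (fun y => fderiv ℝ f y (e i)) x (e i) := by
  have hd : DifferentiableAt ℝ (fderiv ℝ f) x :=
    (hf.fderiv_right (m := 1) (by norm_num)).differentiableAt (by norm_num)
  rw [laplacian_eq_iteratedFDeriv_orthonormalBasis f e]
  refine Finset.sum_congr rfl fun i _ => ?_
  rw [iteratedFDeriv_two_apply, fderiv_clm_apply hd (differentiableAt_const _)]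
  simp

variable [MeasurableSpace E] [BorelSpace E]

theorem integrable_of_continuousOn_closedBall {h : E → ℝ} {r : ℝ}
    (hc : ContinuousOn h (closedBall 0 r)) (h0 : ∀ x ∉ closedBall (0 : E) r, h x = 0) :
    Integrable h :=
  (hc.integrableOn_compact (isCompact_closedBall 0 r)).integrable_of_forall_notMem_eq_zero h0

variable {U V : E → ℝ} {R : ℝ}

omit [FiniteDimensional ℝ E] [MeasurableSpace E] [BorelSpace E] in
theorem fderiv_wronskian_apply {x : E} (hU : ContDiffAt ℝ 2 U x) (hV : ContDiffAt ℝ 2 V x) (v : E) :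
    fderiv ℝ (fun y => U y * fderiv ℝ V y v - V y * fderiv ℝ U y v) x v =
      U x * fderiv ℝ (fun y => fderiv ℝ V y v) x v
        - V x * fderiv ℝ (fun y => fderiv ℝ U y v) x v := by
  have key : ∀ {W : E → ℝ}, ContDiffAt ℝ 2 W x →
      DifferentiableAt ℝ W x ∧ DifferentiableAt ℝ (fun y => fderiv ℝ W y v) x := fun hW =>
    ⟨hW.differentiableAt (by norm_num),
      ((hW.fderiv_right (m := 1) (by norm_num)).differentiableAt (by norm_num)).clm_apply
        (differentiableAt_const _)⟩
  obtain ⟨hU1, hU2⟩ := key hU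
  obtain ⟨hV1, hV2⟩ := key hV
  rw [fderiv_fun_sub (hU1.fun_mul hV2) (hV1.fun_mul hU2), fderiv_fun_mul hU1 hV2,
    fderiv_fun_mul hV1 hU2]
  simp
  ring

/-- Green's second identity, tested against the radial function `χ (‖x‖ ^ 2)`: the Wronskian field
`U ∇V - V ∇U` is divergence free, and the gradient of the test function is
`2 χ' (‖x‖ ^ 2) x`. -/
theorem integral_radial_mul_wronskian_eq_zero
    (hU : HarmonicOnNhd U (ball 0 R)) (hV : HarmonicOnNhd V (ball 0 R))
    {χ k : ℝ → ℝ} (hχ : ∀ q, HasDerivAt χ (k q) q) (hk : Continuous k) {r : ℝ} (hrR : r < R)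
    (hr : 0 ≤ r) (hχ0 : ∀ q, r ^ 2 ≤ q → χ q = 0) :
    ∫ x : E, k (‖x‖ ^ 2) * (U x * fderiv ℝ V x x - V x * fderiv ℝ U x x) = 0 := by
  have hk0 : ∀ q, r ^ 2 < q → k q = 0 := by
    intro q hq
    refine (hχ q).unique ((hasDerivAt_const q (0 : ℝ)).congr_of_eventuallyEq ?_)
    filter_upwards [lt_mem_nhds hq] with p hp using hχ0 p hp.le
  have hout : ∀ x ∉ closedBall (0 : E) r, r ^ 2 < ‖x‖ ^ 2 := by
    intro x hx
    rw [mem_closedBall_zero_iff, not_le] at hx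
    gcongr
  have hsub : closedBall (0 : E) r ⊆ ball 0 R := closedBall_subset_ball hrR
  set e := stdOrthonormalBasis ℝ E
  set G : E → E → ℝ := fun v y => U y * fderiv ℝ V y v - V y * fderiv ℝ U y v with hG
  set c : E → ℝ := fun x => χ (‖x‖ ^ 2) with hc
  have hcd : ∀ x, HasFDerivAt c (k (‖x‖ ^ 2) • ((2 : ℕ) • innerSL ℝ x)) x := by
    intro x
    exact (hχ (‖x‖ ^ 2)).comp_hasFDerivAt x (hasStrictFDerivAt_norm_sq x).hasFDerivAt
  have hcf : ∀ x v, fderiv ℝ c x v = k (‖x‖ ^ 2) * (2 * inner ℝ x v) := by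
    intro x v
    rw [(hcd x).fderiv]; simp
  have hcc : Continuous c := continuous_iff_continuousAt.2 fun x => (hcd x).continuousAt
  have hkc : Continuous fun x : E => k (‖x‖ ^ 2) := hk.comp (by fun_prop)
  have hGC : ∀ v, ContDiffOn ℝ 1 (G v) (ball 0 R) := by
    intro v x hx
    have h1 := fun {W : E → ℝ} (hW : HarmonicOnNhd W (ball 0 R)) =>
      ((hW x hx).1.fderiv_right (m := 1) (by norm_num)).clm_apply (contDiffAt_const (c := v))
    have h2 := fun {W : E → ℝ} (hW : HarmonicOnNhd W (ball 0 R)) =>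
      (hW x hx).1.of_le (m := 1) (by norm_num)
    exact (((h2 hU).mul (h1 hV)).sub ((h2 hV).mul (h1 hU))).contDiffWithinAt
  have hGc : ∀ v, ContinuousOn (G v) (closedBall 0 r) := fun v =>
    (hGC v).continuousOn.mono hsub
  have hGf : ∀ v, ContinuousOn (fun x => fderiv ℝ (G v) x v) (closedBall 0 r) := fun v =>
    (((hGC v).continuousOn_fderiv_of_isOpen isOpen_ball le_rfl).clm_apply
      continuousOn_const).mono hsub
  have hI1 : ∀ v, Integrable fun x => c x * fderiv ℝ (G v) x v := fun v =>
    integrable_of_continuousOn_closedBall (hcc.continuousOn.mul (hGf v)) fun x hx => by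
      simp [hc, hχ0 _ (hout x hx).le]
  have hI2 : ∀ v, Integrable fun x => fderiv ℝ c x v * G v x := fun v =>
    integrable_of_continuousOn_closedBall (r := r)
      (by
        simp_rw [hcf]
        exact (hkc.mul (by fun_prop)).continuousOn.mul (hGc v))
      fun x hx => by simp [hcf, hk0 _ (hout x hx)]
  have hI3 : ∀ v, Integrable fun x => c x * G v x := fun v =>
    integrable_of_continuousOn_closedBall (hcc.continuousOn.mul (hGc v)) fun x hx => by
      simp [hc, hχ0 _ (hout x hx).le]
  have hts : tsupport c ⊆ closedBall 0 r := by
    refine closure_minimal (fun x hx => ?_) isClosed_closedBall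
    by_contra hx'
    exact hx (hχ0 _ (hout x hx').le)
  have hibp : ∀ v, ∫ x, c x * fderiv ℝ (G v) x v = - ∫ x, fderiv ℝ c x v * G v x := fun v =>
    integral_mul_fderiv_eq_neg_fderiv_mul_of_integrable (hI2 v) (hI1 v) (hI3 v)
      (fun x _ => (hcd x).differentiableAt)
      fun x hx => ((hGC v).contDiffAt
        (isOpen_ball.mem_nhds (hsub (hts hx)))).differentiableAt (by norm_num)
  have hsum1 : ∑ i, ∫ x, c x * fderiv ℝ (G (e i)) x (e i) = 0 := by
    rw [← integral_finsetSum _ fun i _ => hI1 (e i)]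
    refine integral_eq_zero_of_ae (ae_of_all _ fun x => ?_)
    by_cases hx : x ∈ closedBall (0 : E) r
    · have h1 := hU x (hsub hx)
      have h2 := hV x (hsub hx)
      have h3 := laplacian_eq_sum_fderiv e h1.1
      have h4 := laplacian_eq_sum_fderiv e h2.1
      rw [h1.2.self_of_nhds] at h3
      rw [h2.2.self_of_nhds] at h4
      simp only [Pi.zero_apply] at h3 h4 ⊢
      rw [← Finset.mul_sum]
      simp_rw [hG, fderiv_wronskian_apply h1.1 h2.1]
      rw [Finset.sum_sub_distrib, ← Finset.mul_sum, ← Finset.mul_sum, ← h3, ← h4]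
      simp
    · simp [hc, hχ0 _ (hout x hx).le]
  have hsum2 : ∑ i, ∫ x, fderiv ℝ c x (e i) * G (e i) x =
      ∫ x : E, 2 * (k (‖x‖ ^ 2) * (U x * fderiv ℝ V x x - V x * fderiv ℝ U x x)) := by
    rw [← integral_finsetSum _ fun i _ => hI2 (e i)]
    refine integral_congr_ae (ae_of_all _ fun x => ?_)
    have hx : ∀ W : E → ℝ, fderiv ℝ W x x = ∑ i, inner ℝ x (e i) * fderiv ℝ W x (e i) := by
      intro W
      conv_lhs => rw [← e.sum_repr x, map_sum]
      rw [e.sum_repr x]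
      simp [e.repr_apply_apply, real_inner_comm]
    simp only [hcf, hG]
    rw [hx U, hx V, Finset.mul_sum, Finset.mul_sum, ← Finset.sum_sub_distrib, Finset.mul_sum,
      Finset.mul_sum]
    exact Finset.sum_congr rfl fun i _ => by ring
  rw [Finset.sum_congr rfl fun i _ => hibp (e i), Finset.sum_neg_distrib, hsum2,
    integral_const_mul] at hsum1
  linarith

end Green

/-! ### Polar coordinates -/

section Polar

variable {E : Type*} [NormedAddCommGroup E] [InnerProductSpace ℝ E] [FiniteDimensional ℝ E]
  [MeasurableSpace E] [BorelSpace E]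

theorem integral_eq_integral_Ioi_integral_sphere [Nontrivial E] {h : E → ℝ} (hh : Integrable h) :
    ∫ x, h x = ∫ r in Set.Ioi (0 : ℝ), r ^ (finrank ℝ E - 1) *
      ∫ ζ : sphere (0 : E) 1, h (r • (ζ : E)) ∂(volume : Measure E).toSphere := by
  set μ : Measure E := volume
  have hmp := μ.measurePreserving_homeomorphUnitSphereProd
  set h' : sphere (0 : E) 1 × Set.Ioi (0 : ℝ) → ℝ := fun p => h ((p.2 : ℝ) • (p.1 : E)) with hh'
  have hcomp : ∀ x : ({0}ᶜ : Set E), h' (homeomorphUnitSphereProd E x) = h x := by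
    intro x
    have hx : ‖(x : E)‖ ≠ 0 := norm_ne_zero_iff.2 x.2
    simp [hh', smul_smul, mul_inv_cancel₀ hx]
  have hint : Integrable h' (μ.toSphere.prod (.volumeIoiPow (finrank ℝ E - 1))) := by
    rw [← hmp.integrable_comp_emb (Homeomorph.measurableEmbedding _)]
    have : h' ∘ (homeomorphUnitSphereProd E) = fun x : ({0}ᶜ : Set E) => h x := funext hcomp
    rw [this]
    exact (integrableOn_iff_comap_subtypeVal (measurableSet_singleton _).compl).1 hh.integrableOn
  calc ∫ x, h x ∂μ = ∫ x : ({(0)}ᶜ : Set E), h x ∂(μ.comap (↑)) := by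
        rw [integral_subtype_comap (measurableSet_singleton _).compl h,
          restrict_compl_singleton]
    _ = ∫ p, h' p ∂(μ.toSphere.prod (.volumeIoiPow (finrank ℝ E - 1))) := by
        rw [← hmp.integral_comp (Homeomorph.measurableEmbedding _)]
        exact integral_congr_ae (ae_of_all _ fun x => (hcomp x).symm)
    _ = ∫ r : Set.Ioi (0 : ℝ), (∫ ζ : sphere (0 : E) 1, h' (ζ, r) ∂μ.toSphere)
          ∂(.volumeIoiPow (finrank ℝ E - 1)) := integral_prod_symm _ hint
    _ = _ := by
      simp only [Measure.volumeIoiPow, ENNReal.ofReal]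
      rw [integral_withDensity_eq_integral_smul,
        integral_subtype_comap measurableSet_Ioi fun a : ℝ ↦
          Real.toNNReal (a ^ (finrank ℝ E - 1)) •
            ∫ ζ : sphere (0 : E) 1, h (a • (ζ : E)) ∂μ.toSphere,
        setIntegral_congr_fun measurableSet_Ioi fun x hx ↦ ?_]
      · rw [NNReal.smul_def, Real.coe_toNNReal _ (pow_nonneg hx.out.le _), smul_eq_mul]
      · exact (measurable_subtype_coe.pow_const _).real_toNNReal

end Polar

/-! ### Integrals over a compact space depending on a parameter -/

section Parametric

variable {X : Type*} [TopologicalSpace X] [CompactSpace X] [MeasurableSpace X] [BorelSpace X]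
  {μ : Measure X} [IsFiniteMeasure μ]

theorem continuousOn_integral_of_compactSpace {Y : Type*} [TopologicalSpace Y] {s : Set Y}
    {F : Y → X → ℝ} (hF : ContinuousOn F.uncurry (s ×ˢ Set.univ)) :
    ContinuousOn (fun t => ∫ x, F t x ∂μ) s :=
  continuousOn_integral_of_compact_support isCompact_univ hF (by simp)

theorem hasDerivAt_integral_of_compactSpace {F F' : ℝ → X → ℝ} {s : Set ℝ} (hs : IsOpen s)
    (hF : ContinuousOn F.uncurry (s ×ˢ Set.univ)) (hF' : ContinuousOn F'.uncurry (s ×ˢ Set.univ))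
    (hd : ∀ t ∈ s, ∀ x, HasDerivAt (F · x) (F' t x) t) {t : ℝ} (ht : t ∈ s) :
    HasDerivAt (fun t => ∫ x, F t x ∂μ) (∫ x, F' t x ∂μ) t := by
  have hsl : ∀ {G : ℝ → X → ℝ}, ContinuousOn G.uncurry (s ×ˢ Set.univ) → ∀ t ∈ s,
      Continuous (G t) := fun hG t ht =>
    hG.comp_continuous (.prodMk_right t) fun x => ⟨ht, trivial⟩
  obtain ⟨K, hK, hKc, hKs⟩ := exists_mem_nhds_isCompact_mapsTo (f := (id : ℝ → ℝ))
    continuous_id (hs.mem_nhds ht)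
  obtain ⟨C, hC⟩ := ((hKc.prod isCompact_univ).bddAbove_image
    ((hF'.mono (Set.prod_mono hKs subset_rfl)).norm))
  refine (hasDerivAt_integral_of_dominated_loc_of_deriv_le (bound := fun _ => C) hK ?_ ?_ ?_ ?_
    (integrable_const _) ?_).2
  · filter_upwards [hs.mem_nhds ht] with u hu using (hsl hF u hu).aestronglyMeasurable
  · exact (hsl hF t ht).integrable_of_hasCompactSupport (HasCompactSupport.of_compactSpace _)
  · exact (hsl hF' t ht).aestronglyMeasurable
  · exact ae_of_all _ fun x u hu => hC ⟨(u, x), ⟨hu, trivial⟩, rfl⟩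
  · exact ae_of_all _ fun x u hu => hd u (hKs hu) x

end Parametric

/-! ### Green's second identity on spheres -/

section SphericalGreen

variable {E : Type*} [NormedAddCommGroup E] [InnerProductSpace ℝ E] [FiniteDimensional ℝ E]
  [MeasurableSpace E] [BorelSpace E]

variable {U V : E → ℝ} {R : ℝ}

omit [FiniteDimensional ℝ E] [MeasurableSpace E] [BorelSpace E] in
theorem continuousOn_smul_sphere {Z : Type*} [TopologicalSpace Z] {W : E → Z} {s : Set ℝ}
    {c : ℝ → ℝ}
    (hc : ContinuousOn c s) (hs : ∀ t ∈ s, |c t| < R) (hW : ContinuousOn W (ball 0 R)) :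
    ContinuousOn (fun p : ℝ × sphere (0 : E) 1 => W (c p.1 • (p.2 : E))) (s ×ˢ Set.univ) := by
  refine hW.comp ?_ ?_
  · exact (hc.comp continuousOn_fst fun p hp => hp.1).smul (by fun_prop)
  · rintro ⟨t, ζ⟩ ⟨ht, -⟩
    simpa [norm_smul] using hs t ht

omit [MeasurableSpace E] [BorelSpace E] in
theorem InnerProductSpace.HarmonicOnNhd.continuousOn_fderiv (hU : HarmonicOnNhd U (ball 0 R)) :
    ContinuousOn (fderiv ℝ U) (ball 0 R) :=
  hU.contDiffOn.continuousOn_fderiv_of_isOpen isOpen_ball (by norm_num)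

/-- Green's second identity on a sphere centred at the origin. It is the weighted identity
`integral_radial_mul_wronskian_eq_zero` in polar coordinates, for all radial weights. -/
theorem integral_sphere_wronskian_eq_zero [Nontrivial E]
    (hU : HarmonicOnNhd U (ball 0 R)) (hV : HarmonicOnNhd V (ball 0 R))
    {ρ : ℝ} (hρ0 : 0 < ρ) (hρ : ρ < R) :
    ∫ ζ : sphere (0 : E) 1, (U (ρ • (ζ : E)) * fderiv ℝ V (ρ • (ζ : E)) ζ
      - V (ρ • (ζ : E)) * fderiv ℝ U (ρ • (ζ : E)) ζ) ∂(volume : Measure E).toSphere = 0 := by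
  set J : ℝ → ℝ := fun t => ∫ ζ : sphere (0 : E) 1, (U (t • (ζ : E)) * fderiv ℝ V (t • (ζ : E)) ζ
      - V (t • (ζ : E)) * fderiv ℝ U (t • (ζ : E)) ζ) ∂(volume : Measure E).toSphere with hJ
  set d := finrank ℝ E
  have habs : ∀ t ∈ Set.Ioo 0 R, |t| < R := fun t ht => by rw [abs_of_pos ht.1]; exact ht.2
  have hJc : ContinuousOn J (Set.Ioo 0 R) := by
    refine continuousOn_integral_of_compactSpace
      (F := fun t (ζ : sphere (0 : E) 1) => U (t • (ζ : E)) * fderiv ℝ V (t • (ζ : E)) ζ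
      - V (t • (ζ : E)) * fderiv ℝ U (t • (ζ : E)) ζ) ?_
    have h1 := fun {W : E → ℝ} (hW : HarmonicOnNhd W (ball 0 R)) =>
      continuousOn_smul_sphere continuousOn_id habs hW.continuousOn
    have h2 := fun {W : E → ℝ} (hW : HarmonicOnNhd W (ball 0 R)) =>
      (continuousOn_smul_sphere continuousOn_id habs
        (HarmonicOnNhd.continuousOn_fderiv hW)).clm_apply
        ((continuous_subtype_val.comp continuous_snd).continuousOn)
    exact ((h1 hU).mul (h2 hV)).sub ((h1 hV).mul (h2 hU))
  have hΦc : ContinuousOn (fun t => t ^ d * J t) (Set.Ioo 0 R) :=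
    (continuous_pow d).continuousOn.mul hJc
  have hd1 : d - 1 + 1 = d := Nat.sub_add_cancel finrank_pos
  have hae : ∀ᵐ t, t ∈ Set.Ioo 0 R → t ^ d * J t = 0 := by
    refine IsOpen.ae_eq_zero_of_integral_contDiff_smul_eq_zero isOpen_Ioo
      (hΦc.locallyIntegrableOn measurableSet_Ioo) fun g hg hgc hgs => ?_
    -- the weight vanishes beyond some `r < R` and, for the extension by zero, at radii `t ≤ 0`
    have hgcont : Continuous g := hg.continuous
    obtain ⟨r, hr0, hrR, hgr⟩ : ∃ r, 0 ≤ r ∧ r < R ∧ ∀ t, r ≤ t → g t = 0 := by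
      rcases (tsupport g).eq_empty_or_nonempty with he | hne
      · refine ⟨0, le_rfl, hρ0.trans hρ, fun t _ => ?_⟩
        exact image_eq_zero_of_notMem_tsupport (by simp [he])
      · obtain ⟨m, hm, hmax⟩ := hgc.isCompact.exists_isMaxOn hne continuousOn_id
        have hmm := hgs hm
        refine ⟨(m + R) / 2, by linarith [hmm.1, hmm.2], by linarith [hmm.2], fun t ht => ?_⟩
        refine image_eq_zero_of_notMem_tsupport fun htm => ?_
        have := hmax htm
        simp only [id, Set.mem_ofPred_eq] at this
        linarith [hmm.2]
    have hg0 : ∀ t, t ≤ 0 → g t = 0 := fun t ht =>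
      image_eq_zero_of_notMem_tsupport fun htm => absurd (hgs htm).1 (not_lt.2 ht)
    -- the radial weight is a primitive in the variable `q = ‖x‖ ^ 2` vanishing from `r ^ 2` on
    set k : ℝ → ℝ := fun q => g (Real.sqrt q)
    have hk : Continuous k := hgcont.comp Real.continuous_sqrt
    have hmain := integral_radial_mul_wronskian_eq_zero hU hV
      (χ := fun q => ∫ s in (r ^ 2)..q, k s) (k := k)
      (fun q => intervalIntegral.integral_hasDerivAt_right (hk.intervalIntegrable _ _)
        (hk.stronglyMeasurableAtFilter _ _) hk.continuousAt) hk hrR hr0 (fun q hq => by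
          refine intervalIntegral.integral_zero_ae (ae_of_all _ fun s hs => hgr _ ?_)
          rw [Set.uIoc_of_le hq] at hs
          exact Real.le_sqrt_of_sq_le hs.1.le)
    have hkn : ∀ x : E, k (‖x‖ ^ 2) = g ‖x‖ := fun x => by
      simp only [k, Real.sqrt_sq (norm_nonneg x)]
    simp_rw [hkn] at hmain
    rw [integral_eq_integral_Ioi_integral_sphere] at hmain
    · rw [← hmain, ← setIntegral_eq_integral_of_forall_compl_eq_zero (s := Set.Ioi 0)]
      · refine setIntegral_congr_fun measurableSet_Ioi fun t ht => ?_
        have ht0 : (0 : ℝ) < t := ht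
        have hn : ∀ ζ : sphere (0 : E) 1, ‖t • (ζ : E)‖ = t := fun ζ => by
          simp [norm_smul, abs_of_pos ht0]
        simp_rw [hn, map_smul, smul_eq_mul]
        have : ∀ ζ : sphere (0 : E) 1, g t * (U (t • (ζ : E)) * (t * fderiv ℝ V (t • (ζ : E)) ζ)
            - V (t • (ζ : E)) * (t * fderiv ℝ U (t • (ζ : E)) ζ)) =
            (g t * t) * (U (t • (ζ : E)) * fderiv ℝ V (t • (ζ : E)) ζ
            - V (t • (ζ : E)) * fderiv ℝ U (t • (ζ : E)) ζ) := fun ζ => by ring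
        simp_rw [this]
        rw [integral_const_mul]
        change g t * (t ^ d * J t) = t ^ (d - 1) * (g t * t * J t)
        rw [← hd1, pow_succ]
        simp only [Nat.add_sub_cancel]
        ring
      · intro t ht
        rw [hg0 t (not_lt.1 ht), zero_smul]
    · refine integrable_of_continuousOn_closedBall (r := r) ?_ fun x hx => ?_
      · have hsub : closedBall (0 : E) r ⊆ ball 0 R := closedBall_subset_ball hrR
        have h1 := fun {W : E → ℝ} (hW : HarmonicOnNhd W (ball 0 R)) =>
          hW.continuousOn.mono hsub
        have h2 := fun {W : E → ℝ} (hW : HarmonicOnNhd W (ball 0 R)) =>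
          ((HarmonicOnNhd.continuousOn_fderiv hW).mono hsub).clm_apply continuousOn_id
        exact (hgcont.comp continuous_norm).continuousOn.mul
          (((h1 hU).mul (h2 hV)).sub ((h1 hV).mul (h2 hU)))
      · rw [mem_closedBall_zero_iff, not_le] at hx
        rw [hgr _ hx.le, zero_mul]
  have heq := Measure.eqOn_open_of_ae_eq (μ := volume) (f := fun t => t ^ d * J t) (g := fun _ => 0)
    ((ae_restrict_iff' measurableSet_Ioo).2 hae) isOpen_Ioo hΦc continuousOn_const
    (⟨hρ0, hρ⟩ : ρ ∈ Set.Ioo 0 R)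
  exact (mul_eq_zero.1 heq).resolve_left (pow_ne_zero _ hρ0.ne')

end SphericalGreen

/-! ### Dilations of harmonic functions and the mean value property -/

section Duality

variable {E : Type*} [NormedAddCommGroup E] [InnerProductSpace ℝ E] [FiniteDimensional ℝ E]

theorem InnerProductSpace.HarmonicAt.comp_smul {u : E → ℝ} {s : ℝ} {x : E}
    (hu : HarmonicAt u (s • x)) :
    HarmonicAt (fun y => u (s • y)) x := by
  have hc : Continuous fun y : E => s • y := continuous_const_smul s
  have hcd : ∀ y, HarmonicAt u (s • y) → ContDiffAt ℝ 2 (fun y => u (s • y)) y := fun y hy =>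
    hy.1.comp y (contDiff_const_smul s).contDiffAt
  refine ⟨hcd x hu, ?_⟩
  filter_upwards [hc.continuousAt.eventually hu.eventually] with y hy
  have h2 := laplacian_eq_sum_fderiv (stdOrthonormalBasis ℝ E) hy.1
  rw [hy.2.self_of_nhds] at h2
  rw [laplacian_eq_sum_fderiv (stdOrthonormalBasis ℝ E) (hcd y hy)]
  have : ∀ v : E, fderiv ℝ (fun z => fderiv ℝ (fun y => u (s • y)) z v) y v =
      s * (s * fderiv ℝ (fun z => fderiv ℝ u z v) (s • y) v) := by
    intro v
    have h : (fun z => fderiv ℝ (fun y => u (s • y)) z v) =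
        fun z => s • (fun z => fderiv ℝ u z v) (s • z) := by
      ext z
      rw [fderiv_comp_smul]; rfl
    have hdiff : DifferentiableAt ℝ (fun z => (fun z => fderiv ℝ u z v) (s • z)) y := by
      refine DifferentiableAt.comp (g := fun z => fderiv ℝ u z v) y ?_
        (differentiableAt_id.const_smul s)
      exact ((hy.1.fderiv_right (m := 1) (by norm_num)).differentiableAt
        (by norm_num)).clm_apply (differentiableAt_const _)
    have h3 := fderiv_comp_smul (𝕜 := ℝ) (f := fun z => fderiv ℝ u z v) s (x := y)
    rw [h, fderiv_fun_const_smul hdiff, h3]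
    rfl
  simp_rw [this, ← Finset.mul_sum, ← h2]
  simp

variable [MeasurableSpace E] [BorelSpace E] [Nontrivial E]

/-- For harmonic `u` and `v`, the integral of `u (s ζ) v (t ζ)` over the unit sphere depends
on `s * t` only: its derivative along `s * t = c` is the spherical Wronskian of the
dilated functions. -/
theorem integral_sphere_dilation_eq {u v : E → ℝ} (hu : HarmonicOnNhd u (ball 0 1))
    (hv : HarmonicOnNhd v (ball 0 1)) {c τ₁ τ₂ : ℝ} (hc : 0 < c) (h₁ : τ₁ ∈ Set.Ioo c 1)
    (h₂ : τ₂ ∈ Set.Ioo c 1) :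
    ∫ ζ : sphere (0 : E) 1, u ((c / τ₁) • (ζ : E)) * v (τ₁ • (ζ : E))
        ∂(volume : Measure E).toSphere =
      ∫ ζ : sphere (0 : E) 1, u ((c / τ₂) • (ζ : E)) * v (τ₂ • (ζ : E))
        ∂(volume : Measure E).toSphere := by
  set F : ℝ → sphere (0 : E) 1 → ℝ := fun τ ζ => u ((c / τ) • (ζ : E)) * v (τ • (ζ : E)) with hF
  set F' : ℝ → sphere (0 : E) 1 → ℝ := fun τ ζ =>
    (-(c / τ ^ 2) * fderiv ℝ u ((c / τ) • (ζ : E)) ζ) * v (τ • (ζ : E))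
      + u ((c / τ) • (ζ : E)) * fderiv ℝ v (τ • (ζ : E)) ζ with hF'
  have hpos : ∀ τ ∈ Set.Ioo c 1, 0 < τ := fun τ hτ => hc.trans hτ.1
  have ha1 : ∀ τ ∈ Set.Ioo c 1, |c / τ| < 1 := fun τ hτ => by
    rw [abs_of_pos (div_pos hc (hpos τ hτ)), div_lt_one (hpos τ hτ)]; exact hτ.1
  have ha2 : ∀ τ ∈ Set.Ioo c 1, |τ| < 1 := fun τ hτ => by
    rw [abs_of_pos (hpos τ hτ)]; exact hτ.2
  have hcc : ContinuousOn (fun τ => c / τ) (Set.Ioo c 1) :=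
    continuousOn_const.div continuousOn_id fun τ hτ => (hpos τ hτ).ne'
  have hcc2 : ContinuousOn (fun τ => -(c / τ ^ 2)) (Set.Ioo c 1) :=
    (continuousOn_const.div (continuous_pow 2).continuousOn
      fun τ hτ => pow_ne_zero _ (hpos τ hτ).ne').neg
  have hsub : ContinuousOn (fun p : ℝ × sphere (0 : E) 1 => (p.2 : E))
      (Set.Ioo c 1 ×ˢ Set.univ) := (continuous_subtype_val.comp continuous_snd).continuousOn
  have hFc : ContinuousOn F.uncurry (Set.Ioo c 1 ×ˢ Set.univ) :=
    (continuousOn_smul_sphere hcc ha1 hu.continuousOn).mul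
      (continuousOn_smul_sphere continuousOn_id ha2 hv.continuousOn)
  have hFc' : ContinuousOn F'.uncurry (Set.Ioo c 1 ×ˢ Set.univ) :=
    (((hcc2.comp continuousOn_fst fun p hp => hp.1).mul
      ((continuousOn_smul_sphere hcc ha1 (HarmonicOnNhd.continuousOn_fderiv hu)).clm_apply
        hsub)).mul (continuousOn_smul_sphere continuousOn_id ha2 hv.continuousOn)).add
    ((continuousOn_smul_sphere hcc ha1 hu.continuousOn).mul
      ((continuousOn_smul_sphere continuousOn_id ha2
        (HarmonicOnNhd.continuousOn_fderiv hv)).clm_apply hsub))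
  have hmem : ∀ {s : ℝ}, |s| < 1 → ∀ ζ : sphere (0 : E) 1, s • (ζ : E) ∈ ball (0 : E) 1 := by
    intro s hs ζ
    simpa [norm_smul] using hs
  have hdiff : ∀ {W : E → ℝ}, HarmonicOnNhd W (ball 0 1) → ∀ x ∈ ball (0 : E) 1,
      HasFDerivAt W (fderiv ℝ W x) x := fun hW x hx =>
    ((hW x hx).1.differentiableAt (by norm_num)).hasFDerivAt
  have hd : ∀ τ ∈ Set.Ioo c 1, ∀ ζ, HasDerivAt (F · ζ) (F' τ ζ) τ := by
    intro τ hτ ζ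
    have h0 := (hpos τ hτ).ne'
    have e1 : HasDerivAt (fun τ : ℝ => (c / τ) • (ζ : E)) ((-(c / τ ^ 2)) • (ζ : E)) τ := by
      have := ((hasDerivAt_id τ).inv h0).const_mul c
      refine HasDerivAt.smul_const ?_ _
      convert! this using 1
      simp only [id]; field_simp
    have e2 : HasDerivAt (fun τ : ℝ => τ • (ζ : E)) ((1 : ℝ) • (ζ : E)) τ :=
      (hasDerivAt_id τ).smul_const _
    have g1 := (hdiff hu _ (hmem (ha1 τ hτ) ζ)).comp_hasDerivAt τ e1
    have g2 := (hdiff hv _ (hmem (ha2 τ hτ) ζ)).comp_hasDerivAt τ e2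
    convert! g1.mul g2 using 1
    simp [hF']
  have hzero : ∀ τ ∈ Set.Ioo c 1, ∫ ζ, F' τ ζ ∂(volume : Measure E).toSphere = 0 := by
    intro τ hτ
    have h0 := hpos τ hτ
    -- both dilations are harmonic in a ball slightly larger than the unit ball
    set R := min (τ / c) (1 / τ) with hR
    have hR1 : 1 < R := lt_min ((one_lt_div hc).2 hτ.1) ((one_lt_div h0).2 hτ.2)
    have hUV : ∀ {W : E → ℝ}, HarmonicOnNhd W (ball 0 1) → ∀ {s : ℝ}, 0 < s → R ≤ 1 / s →
        HarmonicOnNhd (fun x => W (s • x)) (ball 0 R) := by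
      intro W hW s hs hRs x hx
      refine HarmonicAt.comp_smul (hW _ ?_)
      rw [mem_ball_zero_iff] at hx ⊢
      rw [norm_smul, Real.norm_of_nonneg hs.le]
      rw [le_div_iff₀ hs] at hRs
      nlinarith
    have hG := integral_sphere_wronskian_eq_zero
      (hUV hu (div_pos hc h0) (by rw [one_div_div]; exact min_le_left _ _))
      (hUV hv h0 (min_le_right _ _)) one_pos hR1
    have hpt : ∀ ζ : sphere (0 : E) 1,
        u ((c / τ) • (1 : ℝ) • (ζ : E)) * fderiv ℝ (fun x => v (τ • x)) ((1 : ℝ) • (ζ : E)) ζ -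
        v (τ • (1 : ℝ) • (ζ : E)) * fderiv ℝ (fun x => u ((c / τ) • x)) ((1 : ℝ) • (ζ : E)) ζ
        = τ * F' τ ζ := by
      intro ζ
      simp only [one_smul, fderiv_comp_smul, hF']
      simp only [smul_apply, smul_eq_mul]
      field_simp
      ring
    simp_rw [hpt] at hG
    rw [integral_const_mul] at hG
    exact (mul_eq_zero.1 hG).resolve_left h0.ne'
  have hΦ : ∀ τ ∈ Set.Ioo c 1, HasDerivAt (fun t => ∫ ζ, F t ζ ∂(volume : Measure E).toSphere)
      0 τ := fun τ hτ => by
    have := hasDerivAt_integral_of_compactSpace (μ := (volume : Measure E).toSphere)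
      isOpen_Ioo hFc hFc' hd hτ
    rwa [hzero τ hτ] at this
  exact isOpen_Ioo.is_const_of_deriv_eq_zero isPreconnected_Ioo
    (fun τ hτ => (hΦ τ hτ).differentiableAt.differentiableWithinAt)
    (fun τ hτ => (hΦ τ hτ).deriv) h₁ h₂

/-- The mean value property of harmonic functions. -/
theorem integral_sphere_eq_mul_apply_zero {u : E → ℝ} (hu : HarmonicOnNhd u (ball 0 1))
    {s : ℝ} (hs : s ∈ Set.Ioo (0 : ℝ) 1) :
    ∫ ζ : sphere (0 : E) 1, u (s • (ζ : E)) ∂(volume : Measure E).toSphere =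
      (volume : Measure E).toSphere.real Set.univ * u 0 := by
  set M : ℝ → ℝ := fun s => ∫ ζ : sphere (0 : E) 1, u (s • (ζ : E)) ∂(volume : Measure E).toSphere
  have hconst : ∀ t ∈ Set.Ioo (0 : ℝ) 1, M t = M s := by
    intro t ht
    have := integral_sphere_dilation_eq hu (harmonicOnNhd_const (1 : ℝ)) (mul_pos hs.1 ht.1)
      (τ₁ := s) (τ₂ := t) ⟨by nlinarith [hs.1, ht.2], hs.2⟩ ⟨by nlinarith [ht.1, hs.2], ht.2⟩
    rw [mul_div_cancel_left₀ _ hs.1.ne', mul_div_cancel_right₀ _ ht.1.ne'] at this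
    simpa using this
  have hM : ContinuousOn M (Set.Ioo (-1) 1) := by
    refine continuousOn_integral_of_compactSpace
      (F := fun t (ζ : sphere (0 : E) 1) => u (t • (ζ : E))) ?_
    exact continuousOn_smul_sphere continuousOn_id (fun t ht => abs_lt.2 ht) hu.continuousOn
  have h0 : Tendsto M (𝓝[>] 0) (𝓝 (M 0)) :=
    ((hM.continuousAt (Ioo_mem_nhds (by norm_num) one_pos)).tendsto).mono_left nhdsWithin_le_nhds
  have h1 : Tendsto M (𝓝[>] 0) (𝓝 (M s)) := by
    refine tendsto_const_nhds.congr' ?_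
    filter_upwards [Ioo_mem_nhdsGT one_pos] with t ht using (hconst t ht).symm
  have h2 := tendsto_nhds_unique h1 h0
  change M s = _
  rw [h2]
  simp [M]

end Duality

/-! ### The Poisson kernel -/

section PoissonKernel

variable {E : Type*} [NormedAddCommGroup E] [InnerProductSpace ℝ E]

/-- The Poisson kernel of the unit ball with pole `a`, normalised to take the value `1` at the
origin. -/
noncomputable def ballPoissonKernel (a x : E) : ℝ := (1 - ‖x‖ ^ 2) / ‖x - a‖ ^ finrank ℝ E

theorem ballPoissonKernel_nonneg (a : E) {x : E} (hx : ‖x‖ ≤ 1) : 0 ≤ ballPoissonKernel a x := by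
  have : 0 ≤ 1 - ‖x‖ ^ 2 := by nlinarith [norm_nonneg x]
  unfold ballPoissonKernel
  positivity

theorem ballPoissonKernel_eq_rpow (a x : E) :
    ballPoissonKernel a x = (1 - ‖x‖ ^ 2) * (‖x - a‖ ^ 2) ^ (-(finrank ℝ E : ℝ) / 2) := by
  have h : (‖x - a‖ ^ 2) ^ ((finrank ℝ E : ℝ) / 2) = ‖x - a‖ ^ finrank ℝ E := by
    rw [← Real.rpow_natCast, ← Real.rpow_mul (norm_nonneg _), ← Real.rpow_natCast]
    congr 1
    push_cast
    ring
  rw [ballPoissonKernel, div_eq_mul_inv, neg_div, Real.rpow_neg (by positivity), h]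

theorem hasFDerivAt_norm_sub_sq_rpow (a : E) {x : E} (hx : x ≠ a) (β : ℝ) :
    HasFDerivAt (fun y => (‖y - a‖ ^ 2) ^ β)
      ((2 * β * (‖x - a‖ ^ 2) ^ (β - 1)) • innerSL ℝ (x - a)) x := by
  have hq : ‖x - a‖ ^ 2 ≠ 0 := pow_ne_zero _ (norm_ne_zero_iff.2 (sub_ne_zero.2 hx))
  have h1 : HasFDerivAt (fun y : E => ‖y - a‖ ^ 2) ((2 : ℕ) • innerSL ℝ (x - a)) x := by
    have := (hasStrictFDerivAt_norm_sq (x - a)).hasFDerivAt.comp x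
      ((hasFDerivAt_id x).sub_const a)
    simpa using! this
  convert! h1.rpow_const (p := β) (Or.inl hq) using 1
  ext v
  simp
  ring

theorem hasFDerivAt_one_sub_norm_sq (x : E) :
    HasFDerivAt (fun y : E => 1 - ‖y‖ ^ 2) (-((2 : ℕ) • innerSL ℝ x)) x :=
  (hasStrictFDerivAt_norm_sq x).hasFDerivAt.const_sub 1

variable [FiniteDimensional ℝ E]

theorem harmonicAt_ballPoissonKernel {a : E} (ha : ‖a‖ = 1) {x : E} (hx : x ≠ a) :
    HarmonicAt (ballPoissonKernel a) x := by
  set β : ℝ := -(finrank ℝ E : ℝ) / 2 with hβ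
  have hfun : ballPoissonKernel a = fun x => (1 - ‖x‖ ^ 2) * (‖x - a‖ ^ 2) ^ β :=
    funext (ballPoissonKernel_eq_rpow a)
  have hne : ∀ y : E, y ≠ a → ‖y - a‖ ^ 2 ≠ 0 := fun y hy =>
    pow_ne_zero _ (norm_ne_zero_iff.2 (sub_ne_zero.2 hy))
  have hcd : ∀ y, y ≠ a → ContDiffAt ℝ 2 (ballPoissonKernel a) y := by
    intro y hy
    rw [hfun]
    refine ContDiffAt.mul (contDiff_const.sub (contDiff_norm_sq ℝ)).contDiffAt
      (ContDiffAt.rpow_const_of_ne ?_ (hne y hy))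
    exact ((contDiff_id.sub contDiff_const).norm_sq ℝ).contDiffAt
  refine ⟨hcd x hx, ?_⟩
  filter_upwards [isOpen_ne.mem_nhds hx] with y hy
  rw [laplacian_eq_sum_fderiv (stdOrthonormalBasis ℝ E) (hcd y hy)]
  have hP : ∀ z, z ≠ a → ∀ v, fderiv ℝ (ballPoissonKernel a) z v =
      (1 - ‖z‖ ^ 2) * (2 * β * (‖z - a‖ ^ 2) ^ (β - 1) * inner ℝ (z - a) v)
        - (‖z - a‖ ^ 2) ^ β * (2 * inner ℝ z v) := by
    intro z hz v
    rw [hfun, ((hasFDerivAt_one_sub_norm_sq z).fun_mul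
      (hasFDerivAt_norm_sub_sq_rpow a hz β)).fderiv]
    simp [inner_sub_left]
    ring
  have hPP : ∀ v, fderiv ℝ (fun z => fderiv ℝ (ballPoissonKernel a) z v) y v =
      (1 - ‖y‖ ^ 2) * (2 * β * (2 * (β - 1) * (‖y - a‖ ^ 2) ^ (β - 1 - 1)
        * inner ℝ (y - a) v ^ 2 + (‖y - a‖ ^ 2) ^ (β - 1) * ‖v‖ ^ 2))
      - 8 * β * (‖y - a‖ ^ 2) ^ (β - 1) * (inner ℝ (y - a) v * inner ℝ y v)
      - 2 * (‖y - a‖ ^ 2) ^ β * ‖v‖ ^ 2 := by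
    intro v
    have hev : (fun z => fderiv ℝ (ballPoissonKernel a) z v) =ᶠ[𝓝 y] fun z =>
        (1 - ‖z‖ ^ 2) * (2 * β * (‖z - a‖ ^ 2) ^ (β - 1) * inner ℝ (z - a) v)
        - (‖z - a‖ ^ 2) ^ β * (2 * inner ℝ z v) := by
      filter_upwards [isOpen_ne.mem_nhds hy] with z hz using hP z hz v
    have i1 : HasFDerivAt (fun z : E => inner ℝ z v) (innerSL ℝ v) y := by
      have := (innerSL ℝ v).hasFDerivAt (x := y)
      simpa [real_inner_comm] using! this
    have i2 : HasFDerivAt (fun z : E => inner ℝ (z - a) v) (innerSL ℝ v) y := by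
      have : (fun z : E => inner ℝ (z - a) v) = fun z => inner ℝ z v - inner ℝ a v :=
        funext fun z => inner_sub_left _ _ _
      rw [this]
      exact i1.sub_const _
    rw [hev.fderiv_eq, (((hasFDerivAt_one_sub_norm_sq y).fun_mul
      (((hasFDerivAt_norm_sub_sq_rpow a hy (β - 1)).const_mul (2 * β)).fun_mul i2)).fun_sub
      ((hasFDerivAt_norm_sub_sq_rpow a hy β).fun_mul (i1.const_mul 2))).fderiv]
    simp [inner_sub_left]
    ring
  set e := stdOrthonormalBasis ℝ E
  have s1 : ∑ i, inner ℝ (y - a) (e i) ^ 2 = ‖y - a‖ ^ 2 := by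
    simpa using e.sum_sq_norm_inner_left (y - a)
  have s2 : ∑ i, inner ℝ (y - a) (e i) * inner ℝ y (e i) = inner ℝ (y - a) y := by
    rw [← e.sum_inner_mul_inner (y - a) y]
    exact Finset.sum_congr rfl fun i _ => by rw [real_inner_comm (e i) y]
  have s3 : ∑ i, ‖e i‖ ^ 2 = (finrank ℝ E : ℝ) := by simp
  simp_rw [hPP]
  rw [Finset.sum_sub_distrib, Finset.sum_sub_distrib, ← Finset.mul_sum, ← Finset.mul_sum,
    ← Finset.mul_sum, ← Finset.mul_sum, Finset.sum_add_distrib, ← Finset.mul_sum,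
    ← Finset.mul_sum, s1, s2, s3]
  -- all terms are multiples of `‖y - a‖ ^ (2 * (β - 2))`; they cancel because `‖a‖ = 1`
  have hq : 0 < ‖y - a‖ ^ 2 := lt_of_le_of_ne (by positivity) (hne y hy).symm
  have r1 : (‖y - a‖ ^ 2) ^ (β - 1) = ‖y - a‖ ^ 2 * (‖y - a‖ ^ 2) ^ (β - 1 - 1) := by
    conv_rhs => rw [← Real.rpow_one_add' hq.le (by
      have : (0 : ℝ) ≤ finrank ℝ E := by positivity
      simp only [hβ]; intro h; linarith)]
    congr 1; ring
  have r2 : (‖y - a‖ ^ 2) ^ β = ‖y - a‖ ^ 2 * (‖y - a‖ ^ 2) ^ (β - 1) := by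
    nth_rewrite 2 [← Real.rpow_one (‖y - a‖ ^ 2)]
    rw [← Real.rpow_add hq]
    congr 1; ring
  have hn : (finrank ℝ E : ℝ) = -2 * β := by simp only [hβ]; ring
  have hexp : ‖y - a‖ ^ 2 = ‖y‖ ^ 2 - 2 * inner ℝ y a + 1 := by
    rw [norm_sub_sq_real, ha]; ring
  have hin : inner ℝ (y - a) y = ‖y‖ ^ 2 - inner ℝ y a := by
    rw [inner_sub_left, real_inner_self_eq_norm_sq, real_inner_comm]
  simp only [Pi.zero_apply]
  rw [r2, r1, hn, hin]
  set T := (‖y - a‖ ^ 2) ^ (β - 1 - 1)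
  rw [hexp]
  ring

end PoissonKernel

/-! ### The Poisson formula on the ray through the pole -/

section PoissonFormula

variable {E : Type*} [NormedAddCommGroup E] [InnerProductSpace ℝ E] [FiniteDimensional ℝ E]
  [MeasurableSpace E] [BorelSpace E] [Nontrivial E]

omit [InnerProductSpace ℝ E] [FiniteDimensional ℝ E] [MeasurableSpace E] [BorelSpace E]
  [Nontrivial E] in
theorem ne_of_mem_ball_of_norm_eq_one {a : E} (ha : ‖a‖ = 1) {x : E} (hx : x ∈ ball (0 : E) 1) :
    x ≠ a := by
  rintro rfl
  simp [ha] at hx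

omit [MeasurableSpace E] [BorelSpace E] [Nontrivial E] in
theorem harmonicOnNhd_ballPoissonKernel {a : E} (ha : ‖a‖ = 1) :
    HarmonicOnNhd (ballPoissonKernel a) (ball 0 1) := fun _ hx =>
  harmonicAt_ballPoissonKernel ha (ne_of_mem_ball_of_norm_eq_one ha hx)

omit [FiniteDimensional ℝ E] [MeasurableSpace E] [BorelSpace E] [Nontrivial E] in
theorem continuous_smul_sphere {W : E → ℝ} (hW : ContinuousOn W (ball 0 1)) {s : ℝ}
    (hs : s ∈ Set.Ioo (0 : ℝ) 1) : Continuous fun ζ : sphere (0 : E) 1 => W (s • (ζ : E)) := by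
  refine hW.comp_continuous (by fun_prop) fun ζ => ?_
  simpa [norm_smul, abs_of_pos hs.1] using hs.2

omit [Nontrivial E] in
theorem integrable_smul_sphere {W : E → ℝ} (hW : ContinuousOn W (ball 0 1)) {s : ℝ}
    (hs : s ∈ Set.Ioo (0 : ℝ) 1) :
    Integrable (fun ζ : sphere (0 : E) 1 => W (s • (ζ : E))) (volume : Measure E).toSphere :=
  (continuous_smul_sphere hW hs).integrable_of_hasCompactSupport (.of_compactSpace _)

theorem integral_sphere_ballPoissonKernel {a : E} (ha : ‖a‖ = 1) {s : ℝ}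
    (hs : s ∈ Set.Ioo (0 : ℝ) 1) :
    ∫ ζ : sphere (0 : E) 1, ballPoissonKernel a (s • (ζ : E)) ∂(volume : Measure E).toSphere =
      (volume : Measure E).toSphere.real Set.univ := by
  rw [integral_sphere_eq_mul_apply_zero (harmonicOnNhd_ballPoissonKernel ha) hs]
  simp [ballPoissonKernel, ha]

/-- The Poisson integral formula on the ray through the pole. By `integral_sphere_dilation_eq` the
left side does not change when `ρ` is moved to `1` along `s * ρ = const`, where the kernel is an
approximate identity. -/
theorem integral_sphere_mul_ballPoissonKernel {u : E → ℝ} (hu : HarmonicOnNhd u (ball 0 1))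
    {a : E} (ha : ‖a‖ = 1) {s ρ : ℝ} (hs : s ∈ Set.Ioo (0 : ℝ) 1) (hρ : ρ ∈ Set.Ioo (0 : ℝ) 1) :
    ∫ ζ : sphere (0 : E) 1, u (s • (ζ : E)) * ballPoissonKernel a (ρ • (ζ : E))
        ∂(volume : Measure E).toSphere =
      (volume : Measure E).toSphere.real Set.univ * u ((s * ρ) • a) := by
  set σ := (volume : Measure E).toSphere
  set c := s * ρ with hc
  have hc0 : 0 < c := mul_pos hs.1 hρ.1
  have hc1 : c < 1 := by nlinarith [hs.2, hρ.2, hs.1, hρ.1]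
  have hPh := harmonicOnNhd_ballPoissonKernel ha
  have hI : ∀ τ ∈ Set.Ioo c 1, ∫ ζ : sphere (0 : E) 1, u ((c / τ) • (ζ : E)) *
      ballPoissonKernel a (τ • (ζ : E)) ∂σ =
      ∫ ζ : sphere (0 : E) 1, u (s • (ζ : E)) * ballPoissonKernel a (ρ • (ζ : E)) ∂σ := by
    intro τ hτ
    rw [integral_sphere_dilation_eq hu hPh hc0 hτ
      (τ₂ := ρ) ⟨by nlinarith [hs.2, hρ.1], hρ.2⟩, hc, mul_div_cancel_right₀ _ hρ.1.ne']
  set I₀ := ∫ ζ : sphere (0 : E) 1, u (s • (ζ : E)) * ballPoissonKernel a (ρ • (ζ : E)) ∂σ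
  have hca : c • a ∈ ball (0 : E) 1 := by
    simpa [norm_smul, ha, abs_of_pos hc0] using hc1
  -- a bound for the dilations of `u` that occur
  set r := 2 * c / (1 + c) with hr
  have hr1 : r < 1 := by rw [hr, div_lt_one (by linarith)]; linarith
  obtain ⟨M, hM⟩ : ∃ M, ∀ x ∈ closedBall (0 : E) r, |u x| ≤ M := by
    obtain ⟨M, hM⟩ := (isCompact_closedBall (0 : E) r).exists_bound_of_continuousOn
      (hu.continuousOn.mono (closedBall_subset_ball hr1))
    exact ⟨M, hM⟩
  have hcr : c ≤ r := by rw [hr, le_div_iff₀ (by linarith)]; nlinarith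
  have hM0 : 0 ≤ M := (abs_nonneg _).trans (hM 0 (by simpa using hc0.le.trans hcr))
  have hmain : ∀ ε > 0, |I₀ - σ.real Set.univ * u (c • a)| ≤ ε * σ.real Set.univ := by
    intro ε hε
    obtain ⟨δ, hδ, η, hη, hclose⟩ : ∃ δ > 0, ∃ η > 0, ∀ τ ∈ Set.Ioo c 1, |τ - 1| < η →
        ∀ ζ : sphere (0 : E) 1, ‖(ζ : E) - a‖ < δ → |u ((c / τ) • (ζ : E)) - u (c • a)| < ε := by
      have hcont : ContinuousAt (fun p : ℝ × E => u ((c / p.1) • p.2)) (1, a) := by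
        have h1 : ContinuousAt u ((c / ((1 : ℝ), a).1) • ((1 : ℝ), a).2) := by
          simpa using hu.continuousOn.continuousAt (isOpen_ball.mem_nhds hca)
        refine ContinuousAt.comp (g := u) h1 ?_
        exact (continuousAt_const.div continuousAt_fst one_ne_zero).smul continuousAt_snd
      obtain ⟨δ, hδ, h⟩ := Metric.continuousAt_iff.1 hcont ε hε
      refine ⟨δ, hδ, δ, hδ, fun τ _ hτ ζ hζ => ?_⟩
      have := @h (τ, (ζ : E)) (by
        rw [Prod.dist_eq, Real.dist_eq, dist_eq_norm]
        exact max_lt hτ hζ)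
      simpa [Real.dist_eq] using this
    set n := finrank ℝ E
    set K := 2 * M / (δ / 2) ^ n with hK
    have hest : ∀ᶠ τ in 𝓝[<] (1 : ℝ), |I₀ - σ.real Set.univ * u (c • a)| ≤
        ε * σ.real Set.univ + K * (1 - τ ^ 2) * σ.real Set.univ := by
      have hev : Set.Ioo (max (max c ((1 + c) / 2)) (max (1 - δ / 2) (1 - η))) 1
          ∈ 𝓝[<] (1 : ℝ) := Ioo_mem_nhdsLT (by
        refine max_lt (max_lt hc1 (by linarith)) (max_lt (by linarith) (by linarith)))
      filter_upwards [hev] with τ hτ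
      obtain ⟨hτ', hτ1⟩ := hτ
      rw [max_lt_iff, max_lt_iff, max_lt_iff] at hτ'
      obtain ⟨⟨hcτ, hτr⟩, hτδ, hτη⟩ := hτ'
      have hτ0 : 0 < τ := hc0.trans hcτ
      have hτm : τ ∈ Set.Ioo (0 : ℝ) 1 := ⟨hτ0, hτ1⟩
      have hcτm : c / τ ∈ Set.Ioo (0 : ℝ) 1 := ⟨div_pos hc0 hτ0, (div_lt_one hτ0).2 hcτ⟩
      have hcτr : c / τ ≤ r := by
        rw [hr, div_le_div_iff₀ hτ0 (by linarith)]; nlinarith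
      have hPi : Integrable (fun ζ : sphere (0 : E) 1 => ballPoissonKernel a (τ • (ζ : E))) σ :=
        integrable_smul_sphere hPh.continuousOn hτm
      have huPi : Integrable (fun ζ : sphere (0 : E) 1 => u ((c / τ) • (ζ : E)) *
          ballPoissonKernel a (τ • (ζ : E))) σ :=
        ((continuous_smul_sphere hu.continuousOn hcτm).mul
          (continuous_smul_sphere hPh.continuousOn hτm)).integrable_of_hasCompactSupport
          (.of_compactSpace _)
      have hdiff : I₀ - σ.real Set.univ * u (c • a) = ∫ ζ : sphere (0 : E) 1,
          (u ((c / τ) • (ζ : E)) * ballPoissonKernel a (τ • (ζ : E))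
            - ballPoissonKernel a (τ • (ζ : E)) * u (c • a)) ∂σ := by
        rw [integral_sub huPi (hPi.mul_const _), hI τ ⟨hcτ, hτ1⟩, integral_mul_const,
          integral_sphere_ballPoissonKernel ha hτm]
      have hbound : ∫ ζ : sphere (0 : E) 1, (ε * ballPoissonKernel a (τ • (ζ : E))
          + K * (1 - τ ^ 2)) ∂σ = ε * σ.real Set.univ + K * (1 - τ ^ 2) * σ.real Set.univ := by
        rw [integral_add (hPi.const_mul _) (integrable_const _), integral_const_mul,
          integral_sphere_ballPoissonKernel ha hτm, integral_const, smul_eq_mul]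
        ring
      rw [hdiff, ← hbound, ← Real.norm_eq_abs]
      refine norm_integral_le_of_norm_le ((hPi.const_mul _).add (integrable_const _))
        (ae_of_all _ fun ζ => ?_)
      have hζ1 : ‖(ζ : E)‖ = 1 := by simp
      have hnτ : ‖τ • (ζ : E)‖ = τ := by rw [norm_smul, hζ1, Real.norm_of_nonneg hτ0.le, mul_one]
      have hP0 : 0 ≤ ballPoissonKernel a (τ • (ζ : E)) :=
        ballPoissonKernel_nonneg a (by rw [hnτ]; exact hτ1.le)
      have h1τ : 0 ≤ 1 - τ ^ 2 := by nlinarith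
      have hK0 : 0 ≤ K := by positivity
      have hfac : u ((c / τ) • (ζ : E)) * ballPoissonKernel a (τ • (ζ : E))
            - ballPoissonKernel a (τ • (ζ : E)) * u (c • a) =
          (u ((c / τ) • (ζ : E)) - u (c • a)) * ballPoissonKernel a (τ • (ζ : E)) := by ring
      rw [hfac, norm_mul, Real.norm_eq_abs, Real.norm_of_nonneg hP0]
      rcases lt_or_ge ‖(ζ : E) - a‖ δ with hlt | hge
      · have := hclose τ ⟨hcτ, hτ1⟩ (by rw [abs_sub_lt_iff]; constructor <;> linarith) ζ hlt
        nlinarith [mul_nonneg hK0 h1τ]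
      · -- away from the pole the kernel is at most a multiple of `1 - τ ^ 2`
        have hfar : δ / 2 ≤ ‖τ • (ζ : E) - a‖ := by
          have h1 : ‖(ζ : E) - a‖ ≤ ‖τ • (ζ : E) - a‖ + ‖(ζ : E) - τ • (ζ : E)‖ := by
            have := norm_add_le (τ • (ζ : E) - a) ((ζ : E) - τ • (ζ : E))
            simpa using this
          have h2 : ‖(ζ : E) - τ • (ζ : E)‖ = 1 - τ := by
            have : (ζ : E) - τ • (ζ : E) = (1 - τ) • (ζ : E) := by rw [sub_smul, one_smul]
            rw [this, norm_smul, hζ1, Real.norm_of_nonneg (by linarith), mul_one]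
          linarith
        have hPle : ballPoissonKernel a (τ • (ζ : E)) ≤ (1 - τ ^ 2) / (δ / 2) ^ n := by
          rw [ballPoissonKernel, hnτ]
          gcongr
        have hu2 : |u ((c / τ) • (ζ : E)) - u (c • a)| ≤ 2 * M := by
          have h1 := hM ((c / τ) • (ζ : E)) (by
            rw [mem_closedBall_zero_iff, norm_smul, hζ1, Real.norm_of_nonneg hcτm.1.le, mul_one]
            exact hcτr)
          have h2 := hM (c • a) (by
            rw [mem_closedBall_zero_iff, norm_smul, ha, Real.norm_of_nonneg hc0.le, mul_one]
            exact hcr)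
          calc _ ≤ |u ((c / τ) • (ζ : E))| + |u (c • a)| := abs_sub _ _
            _ ≤ 2 * M := by linarith
        calc _ ≤ 2 * M * ((1 - τ ^ 2) / (δ / 2) ^ n) :=
              mul_le_mul hu2 hPle hP0 (by linarith)
          _ = K * (1 - τ ^ 2) := by rw [hK]; ring
          _ ≤ _ := le_add_of_nonneg_left (mul_nonneg hε.le hP0)
    have hlim : Tendsto (fun τ : ℝ => ε * σ.real Set.univ + K * (1 - τ ^ 2) * σ.real Set.univ)
        (𝓝[<] 1) (𝓝 (ε * σ.real Set.univ)) := by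
      have : Continuous fun τ : ℝ =>
          ε * σ.real Set.univ + K * (1 - τ ^ 2) * σ.real Set.univ := by fun_prop
      have h := (this.tendsto 1).mono_left (nhdsWithin_le_nhds (s := Set.Iio 1))
      simpa using h
    exact ge_of_tendsto hlim hest
  have hz : |I₀ - σ.real Set.univ * u (c • a)| ≤ 0 := by
    have hlim : Tendsto (fun ε : ℝ => ε * σ.real Set.univ) (𝓝[>] 0) (𝓝 0) := by
      have : Continuous fun ε : ℝ => ε * σ.real Set.univ := by fun_prop
      simpa using (this.tendsto 0).mono_left (nhdsWithin_le_nhds (s := Set.Ioi 0))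
    exact ge_of_tendsto hlim (by filter_upwards [self_mem_nhdsWithin] with ε hε using hmain ε hε)
  exact sub_eq_zero.1 (abs_eq_zero.1 (le_antisymm hz (abs_nonneg _)))

end PoissonFormula

/-! ### The extremal density -/

section Hemisphere

variable {E : Type*} [NormedAddCommGroup E] [InnerProductSpace ℝ E] [FiniteDimensional ℝ E]
  [MeasurableSpace E] [BorelSpace E]

/-- The open hemisphere of the unit sphere opposite to `a`. -/
def oppositeHemisphere (a : E) : Set (sphere (0 : E) 1) := {ζ | inner ℝ (ζ : E) a < 0}

omit [FiniteDimensional ℝ E] in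
theorem measurableSet_oppositeHemisphere (a : E) : MeasurableSet (oppositeHemisphere a) := by
  have hc : Continuous fun ζ : sphere (0 : E) 1 => inner ℝ (ζ : E) a := by fun_prop
  exact (isOpen_Iio.preimage hc).measurableSet

theorem two_mul_toSphere_oppositeHemisphere_le (a : E) :
    2 * (volume : Measure E).toSphere.real (oppositeHemisphere a) ≤
      (volume : Measure E).toSphere.real Set.univ := by
  set σ := (volume : Measure E).toSphere
  have hneg : σ (oppositeHemisphere (-a)) = σ (oppositeHemisphere a) := by
    rw [Measure.toSphere_apply' _ (measurableSet_oppositeHemisphere _),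
      Measure.toSphere_apply' _ (measurableSet_oppositeHemisphere _)]
    congr 1
    rw [← Measure.measure_neg]
    congr 1
    ext x
    simp only [Set.mem_neg, Set.mem_smul, Set.mem_image, oppositeHemisphere]
    constructor
    · rintro ⟨t, ht, _, ⟨ζ, hζ, rfl⟩, hx⟩
      refine ⟨t, ht, _, ⟨-ζ, ?_, rfl⟩, ?_⟩
      · simpa using hζ
      · simp [hx]
    · rintro ⟨t, ht, _, ⟨ζ, hζ, rfl⟩, hx⟩
      refine ⟨t, ht, _, ⟨-ζ, ?_, rfl⟩, ?_⟩
      · simpa using hζ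
      · simp [hx]
  have hdisj : Disjoint (oppositeHemisphere a) (oppositeHemisphere (-a)) := by
    rw [Set.disjoint_left]
    intro ζ h1 h2
    simp only [oppositeHemisphere, Set.mem_ofPred_eq, inner_neg_right] at h1 h2
    linarith
  have h := measureReal_union (μ := σ) hdisj (measurableSet_oppositeHemisphere (-a))
  have hle : σ.real (oppositeHemisphere a ∪ oppositeHemisphere (-a)) ≤ σ.real Set.univ :=
    measureReal_mono (Set.subset_univ _)
  have h' : σ.real (oppositeHemisphere (-a)) = σ.real (oppositeHemisphere a) := by
    rw [Measure.real, hneg, Measure.real]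
  linarith

/-- Lower bound for a harmonic function `w` with values in `[0, 2]` and `w 0 = 1`: among the
densities with values in `[0, 2]` and mean `1`, the Poisson integral at `ρ • a` is smallest for
the density `2` on the hemisphere opposite to `a`, since the kernel is below its equatorial value
exactly there. -/
theorem mul_integral_oppositeHemisphere_le [Nontrivial E] {w : E → ℝ}
    (hw : HarmonicOnNhd w (ball 0 1))
    (hw0 : ∀ x ∈ ball (0 : E) 1, 0 ≤ w x) (hw2 : ∀ x ∈ ball (0 : E) 1, w x ≤ 2) (hw1 : w 0 = 1)
    {a : E} (ha : ‖a‖ = 1) {ρ : ℝ} (hρ : ρ ∈ Set.Ioo (0 : ℝ) 1) :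
    (1 - ρ ^ 2) * (2 * ∫ ζ in oppositeHemisphere a, (‖(ζ : E) - a‖ ^ finrank ℝ E)⁻¹
        ∂(volume : Measure E).toSphere) ≤
      (volume : Measure E).toSphere.real Set.univ * w (ρ • a) := by
  set σ := (volume : Measure E).toSphere with hσ
  set n := finrank ℝ E
  set S := oppositeHemisphere a
  have hS : MeasurableSet S := measurableSet_oppositeHemisphere a
  have hPh := harmonicOnNhd_ballPoissonKernel ha
  have h1ρ : 0 ≤ 1 - ρ ^ 2 := by nlinarith [hρ.1, hρ.2]
  set P : sphere (0 : E) 1 → ℝ := fun ζ => ballPoissonKernel a (ρ • (ζ : E)) with hP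
  have hPi : Integrable P σ := integrable_smul_sphere hPh.continuousOn hρ
  -- the value of the kernel on the equator
  set c := (1 - ρ ^ 2) / (Real.sqrt (1 + ρ ^ 2)) ^ n with hc
  have hc0 : 0 ≤ c := by positivity
  have hnρ : ∀ ζ : sphere (0 : E) 1, ‖ρ • (ζ : E)‖ = ρ := fun ζ => by
    simp [norm_smul, abs_of_pos hρ.1]
  have hexp : ∀ t : ℝ, ∀ ζ : sphere (0 : E) 1, ‖t • (ζ : E) - a‖ ^ 2 =
      1 + t ^ 2 - 2 * t * inner ℝ (ζ : E) a := fun t ζ => by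
    rw [norm_sub_sq_real, ha, norm_smul, inner_smul_left]
    simp
    ring
  have hsq : ∀ {x y : ℝ}, 0 ≤ y → x ^ 2 ≤ y ^ 2 → x ≤ y := fun hy h =>
    (abs_le_of_sq_le_sq' h hy).2
  have hpos : ∀ ζ : sphere (0 : E) 1, 0 < ‖ρ • (ζ : E) - a‖ := fun ζ => by
    refine norm_pos_iff.2 (sub_ne_zero.2 (ne_of_mem_ball_of_norm_eq_one ha ?_))
    rw [mem_ball_zero_iff, hnρ]; exact hρ.2
  have hsqrt : Real.sqrt (1 + ρ ^ 2) ^ 2 = 1 + ρ ^ 2 := Real.sq_sqrt (by positivity)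
  have hPS : ∀ ζ ∈ S, P ζ ≤ c := by
    intro ζ hζ
    have hζ' : inner ℝ (ζ : E) a < 0 := hζ
    simp only [hP, ballPoissonKernel, hc, hnρ]
    gcongr
    refine hsq (norm_nonneg _) ?_
    rw [hsqrt, hexp]
    nlinarith [hρ.1]
  have hPS' : ∀ ζ ∉ S, c ≤ P ζ := by
    intro ζ hζ
    have hζ' : 0 ≤ inner ℝ (ζ : E) a := not_lt.1 hζ
    simp only [hP, ballPoissonKernel, hc, hnρ]
    have := hpos ζ
    gcongr
    refine hsq (Real.sqrt_nonneg _) ?_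
    rw [hsqrt, hexp]
    nlinarith [hρ.1, mul_nonneg hρ.1.le hζ']
  have hPlow : ∀ ζ ∈ S, (1 - ρ ^ 2) * (‖(ζ : E) - a‖ ^ n)⁻¹ ≤ P ζ := by
    intro ζ hζ
    have hζ' : inner ℝ (ζ : E) a < 0 := hζ
    simp only [hP, ballPoissonKernel, hnρ, div_eq_mul_inv]
    have := hpos ζ
    gcongr
    refine hsq (norm_nonneg _) ?_
    have h1 := hexp 1 ζ
    rw [one_smul] at h1
    rw [h1, hexp]
    nlinarith [hρ.1, hρ.2]
  -- `w` need not have boundary values, so the estimate is made for its dilations by `s < 1`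
  have hstep : ∀ s ∈ Set.Ioo (0 : ℝ) 1,
      (1 - ρ ^ 2) * (2 * ∫ ζ in S, (‖(ζ : E) - a‖ ^ n)⁻¹ ∂σ) ≤
        σ.real Set.univ * w ((s * ρ) • a) := by
    intro s hs
    have hm : ∀ ζ : sphere (0 : E) 1, s • (ζ : E) ∈ ball (0 : E) 1 := fun ζ => by
      simpa [norm_smul, abs_of_pos hs.1] using hs.2
    have hwi : Integrable (fun ζ : sphere (0 : E) 1 => w (s • (ζ : E))) σ :=
      integrable_smul_sphere hw.continuousOn hs
    have hwPi : Integrable (fun ζ : sphere (0 : E) 1 => w (s • (ζ : E)) * P ζ) σ :=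
      ((continuous_smul_sphere hw.continuousOn hs).mul
        (continuous_smul_sphere hPh.continuousOn hρ)).integrable_of_hasCompactSupport
        (.of_compactSpace _)
    have hSi : Integrable (S.indicator fun ζ => 2 * (P ζ - c)) σ :=
      ((hPi.sub (integrable_const c)).const_mul 2).indicator hS
    -- the mean of `w` is fixed, so only `w * (P - c)` matters; it is at least `2 * (P - c)` on `S`
    -- and at least `0` off `S`
    have h1 : ∫ ζ, (c * w (s • (ζ : E)) + S.indicator (fun ζ => 2 * (P ζ - c)) ζ) ∂σ ≤
        ∫ ζ : sphere (0 : E) 1, w (s • (ζ : E)) * P ζ ∂σ := by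
      refine integral_mono ((hwi.const_mul c).add hSi) hwPi fun ζ => ?_
      by_cases hζ : ζ ∈ S
      · simp only [Set.indicator_of_mem hζ]
        nlinarith [hPS ζ hζ, hw2 _ (hm ζ)]
      · simp only [Set.indicator_of_notMem hζ]
        nlinarith [hPS' ζ hζ, hw0 _ (hm ζ)]
    rw [integral_sphere_mul_ballPoissonKernel hw ha hs hρ, integral_add (hwi.const_mul c) hSi,
      integral_const_mul, integral_sphere_eq_mul_apply_zero hw hs, hw1,
      integral_indicator hS, integral_const_mul,
      integral_sub hPi.integrableOn (integrable_const c), setIntegral_const, smul_eq_mul] at h1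
    have h2 : (1 - ρ ^ 2) * ∫ ζ in S, (‖(ζ : E) - a‖ ^ n)⁻¹ ∂σ ≤ ∫ ζ in S, P ζ ∂σ := by
      rw [← integral_const_mul]
      refine integral_mono_of_nonneg (ae_of_all _ fun ζ => by positivity) hPi.integrableOn ?_
      exact (ae_restrict_iff' hS).2 (ae_of_all _ hPlow)
    have h3 := two_mul_toSphere_oppositeHemisphere_le a
    rw [← hσ] at h3
    nlinarith
  have hca : ρ • a ∈ ball (0 : E) 1 := by
    simpa [norm_smul, ha, abs_of_pos hρ.1] using hρ.2
  have hcont : ContinuousAt (fun s : ℝ => w ((s * ρ) • a)) 1 := by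
    refine ContinuousAt.comp (g := w) (f := fun s : ℝ => (s * ρ) • a) ?_ (by fun_prop)
    simpa using hw.continuousOn.continuousAt (isOpen_ball.mem_nhds hca)
  have hlim : Tendsto (fun s : ℝ => σ.real Set.univ * w ((s * ρ) • a)) (𝓝[<] 1)
      (𝓝 (σ.real Set.univ * w (ρ • a))) := by
    have := (hcont.tendsto.const_mul (σ.real Set.univ)).mono_left
      (nhdsWithin_le_nhds (s := Set.Iio 1))
    simpa using this
  refine ge_of_tendsto hlim ?_
  filter_upwards [Ioo_mem_nhdsLT one_pos] with s hs using hstep s hs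

end Hemisphere

/-! ### The gnomonic projection of the opposite hemisphere -/

section Gnomonic

/-- There are cylindrical coordinates on `ℝ^(m+1)` with axis `-a`. -/
theorem exists_measurePreserving_prod {m : ℕ} {a : EuclideanSpace ℝ (Fin (m + 1))}
    (ha : ‖a‖ = 1) :
    ∃ Φ : ℝ × EuclideanSpace ℝ (Fin m) → EuclideanSpace ℝ (Fin (m + 1)),
      MeasurePreserving Φ ∧ MeasurableEmbedding Φ ∧
        ∀ q, inner ℝ (Φ q) a = -q.1 ∧ ‖Φ q‖ = Real.sqrt (q.1 ^ 2 + ‖q.2‖ ^ 2) := by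
  have hd : finrank ℝ (WithLp 2 (ℝ × EuclideanSpace ℝ (Fin m))) = m + 1 := by
    rw [(WithLp.linearEquiv 2 ℝ _).finrank_eq]; simp; ring
  set T₀ := ((stdOrthonormalBasis ℝ (WithLp 2 (ℝ × EuclideanSpace ℝ (Fin m)))).reindex
    (finCongr hd)).repr
  set v := T₀ (WithLp.toLp 2 (1, 0)) with hv
  have hnorm : ∀ q : ℝ × EuclideanSpace ℝ (Fin m),
      ‖WithLp.toLp 2 q‖ = Real.sqrt (q.1 ^ 2 + ‖q.2‖ ^ 2) := fun q => by
    rw [← Real.sqrt_sq (norm_nonneg (WithLp.toLp 2 q)), WithLp.prod_norm_sq_eq_of_L2]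
    simp
  have hn : ‖v‖ = ‖-a‖ := by
    rw [norm_neg, ha, hv, T₀.norm_map, hnorm]
    simp
  -- a reflection takes the axis of the product to `-a`
  set T := T₀.trans (ℝ ∙ (v - -a))ᗮ.reflection
  have hT : T (WithLp.toLp 2 (1, 0)) = -a := Submodule.reflection_sub hn
  refine ⟨fun q => T (WithLp.toLp 2 q),
    T.measurePreserving.comp (WithLp.volume_preserving_toLp _ _),
    T.toHomeomorph.measurableEmbedding.comp (MeasurableEquiv.toLp 2 _).measurableEmbedding,
    fun q => ⟨?_, by rw [T.norm_map, hnorm]⟩⟩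
  rw [← neg_neg a, ← hT, inner_neg_right, T.inner_map_map, WithLp.prod_inner_apply]
  simp

/-- An integrable weight on `ℝ^(m+1)`, as a function of `c = ⟪x, a⟫` and `r = ‖x‖`: the product
of `exp (-‖x‖)` and the positively homogeneous extension of `ζ ↦ ‖ζ - a‖ ^ (-(m + 1))` from the
hemisphere opposite to `a`. -/
noncomputable def hemisphereWeight (m : ℕ) (c r : ℝ) : ℝ :=
  (Set.Iio (0 : ℝ)).indicator
    (fun c => Real.exp (-r) * (2 * (1 - c / r)) ^ (-((m : ℝ) + 1) / 2)) c

theorem measurable_hemisphereWeight (m : ℕ) :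
    Measurable (Function.uncurry (hemisphereWeight m)) := by
  have : Function.uncurry (hemisphereWeight m) = (Set.Iio (0 : ℝ) ×ˢ (Set.univ : Set ℝ)).indicator
      (fun p : ℝ × ℝ => Real.exp (-p.2) * (2 * (1 - p.1 / p.2)) ^ (-((m : ℝ) + 1) / 2)) := by
    ext ⟨c, r⟩
    by_cases hc : c < 0 <;> simp [hemisphereWeight, Set.indicator, hc]
  rw [this]
  refine Measurable.indicator ?_ (measurableSet_Iio.prod MeasurableSet.univ)
  exact (Real.measurable_exp.comp measurable_snd.neg).mul
    ((((measurable_fst.div measurable_snd).const_sub 1).const_mul 2).pow_const _)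

theorem neg_half_succ_nonpos (m : ℕ) : -((m : ℝ) + 1) / 2 ≤ 0 := by
  have : (0 : ℝ) ≤ m := by positivity
  linarith

theorem norm_hemisphereWeight_le (m : ℕ) (c : ℝ) {r : ℝ} (hr : 0 ≤ r) :
    ‖hemisphereWeight m c r‖ ≤ Real.exp (-r) := by
  by_cases hc : c < 0
  · simp only [hemisphereWeight, Set.indicator_of_mem (show c ∈ Set.Iio (0 : ℝ) from hc)]
    have h1 : c / r ≤ 0 := div_nonpos_of_nonpos_of_nonneg hc.le hr
    have h2 : (2 * (1 - c / r)) ^ (-((m : ℝ) + 1) / 2) ≤ 1 :=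
      Real.rpow_le_one_of_one_le_of_nonpos (by linarith) (neg_half_succ_nonpos m)
    have h3 : 0 ≤ (2 * (1 - c / r)) ^ (-((m : ℝ) + 1) / 2) := Real.rpow_nonneg (by linarith) _
    rw [norm_mul, Real.norm_of_nonneg (Real.exp_nonneg _), Real.norm_of_nonneg h3]
    exact mul_le_of_le_one_right (Real.exp_nonneg _) h2
  · simp only [hemisphereWeight, Set.indicator_of_notMem (show c ∉ Set.Iio (0 : ℝ) from hc),
      norm_zero]
    exact Real.exp_nonneg _

section Polar

variable {E : Type*} [NormedAddCommGroup E] [InnerProductSpace ℝ E] [FiniteDimensional ℝ E]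
  [MeasurableSpace E] [BorelSpace E] [Nontrivial E]

theorem integrable_hemisphereWeight {m : ℕ} (hm : finrank ℝ E = m + 1) (a : E) :
    Integrable fun x : E => hemisphereWeight m (inner ℝ x a) ‖x‖ := by
  have hGamma : IntegrableOn (fun r : ℝ => r ^ m * Real.exp (-r)) (Set.Ioi 0) := by
    refine (Real.GammaIntegral_convergent (s := (m : ℝ) + 1) (by positivity)).congr_fun
      (fun r _ => ?_) measurableSet_Ioi
    simp [mul_comm]
  have hexp : Integrable (fun x : E => Real.exp (-‖x‖)) := by
    rw [integrable_fun_norm_addHaar (volume : Measure E) (f := fun r => Real.exp (-r))]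
    simpa [hm] using hGamma
  refine hexp.mono' ((measurable_hemisphereWeight m).comp
    (f := fun x : E => (inner ℝ x a, ‖x‖)) ?_).aestronglyMeasurable
    (ae_of_all _ fun x => norm_hemisphereWeight_le m _ (norm_nonneg _))
  exact Continuous.measurable (by fun_prop)

/-- The weight in polar coordinates: the radial integral is a Gamma function. -/
theorem integral_hemisphereWeight_eq_integral_oppositeHemisphere {m : ℕ}
    (hm : finrank ℝ E = m + 1) {a : E} (ha : ‖a‖ = 1) :
    ∫ x : E, hemisphereWeight m (inner ℝ x a) ‖x‖ = Real.Gamma (m + 1) *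
      ∫ ζ in oppositeHemisphere a, (‖(ζ : E) - a‖ ^ (m + 1))⁻¹ ∂(volume : Measure E).toSphere := by
  rw [integral_eq_integral_Ioi_integral_sphere (integrable_hemisphereWeight hm a)]
  set K := ∫ ζ in oppositeHemisphere a, (‖(ζ : E) - a‖ ^ (m + 1))⁻¹ ∂(volume : Measure E).toSphere
    with hK
  have hinner : ∀ r ∈ Set.Ioi (0 : ℝ), r ^ (finrank ℝ E - 1) *
      ∫ ζ : sphere (0 : E) 1, hemisphereWeight m (inner ℝ (r • (ζ : E)) a) ‖r • (ζ : E)‖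
        ∂(volume : Measure E).toSphere = r ^ (((m : ℝ) + 1) - 1) * Real.exp (-(1 * r)) * K := by
    intro r hr
    have hr0 : (0 : ℝ) < r := hr
    have : ∀ ζ : sphere (0 : E) 1, hemisphereWeight m (inner ℝ (r • (ζ : E)) a) ‖r • (ζ : E)‖ =
        (oppositeHemisphere a).indicator
          (fun ζ => Real.exp (-r) * (‖(ζ : E) - a‖ ^ (m + 1))⁻¹) ζ := by
      intro ζ
      have hn : ‖r • (ζ : E)‖ = r := by simp [norm_smul, abs_of_pos hr0]
      rw [hn, inner_smul_left]
      by_cases hζ : inner ℝ (ζ : E) a < 0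
      · rw [Set.indicator_of_mem (show ζ ∈ oppositeHemisphere a from hζ)]
        have hmem : r * inner ℝ (ζ : E) a ∈ Set.Iio (0 : ℝ) := mul_neg_of_pos_of_neg hr0 hζ
        simp only [hemisphereWeight, conj_trivial, Set.indicator_of_mem hmem]
        rw [mul_div_cancel_left₀ _ hr0.ne']
        have hsq : 2 * (1 - inner ℝ (ζ : E) a) = ‖(ζ : E) - a‖ ^ 2 := by
          rw [norm_sub_sq_real, ha]; simp; ring
        have hpow : (‖(ζ : E) - a‖ ^ 2) ^ (((m : ℝ) + 1) / 2) = ‖(ζ : E) - a‖ ^ (m + 1) := by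
          rw [← Real.rpow_natCast, ← Real.rpow_mul (norm_nonneg _), ← Real.rpow_natCast]
          congr 1
          push_cast
          ring
        rw [hsq, neg_div, Real.rpow_neg (by positivity), hpow]
      · rw [Set.indicator_of_notMem (show ζ ∉ oppositeHemisphere a from hζ)]
        have hmem : r * inner ℝ (ζ : E) a ∉ Set.Iio (0 : ℝ) :=
          not_lt.2 (mul_nonneg hr0.le (not_lt.1 hζ))
        simp only [hemisphereWeight, conj_trivial, Set.indicator_of_notMem hmem]
    simp_rw [this]
    rw [integral_indicator (measurableSet_oppositeHemisphere a), integral_const_mul, ← hK, hm]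
    simp
    ring
  rw [setIntegral_congr_fun measurableSet_Ioi hinner, integral_mul_const,
    Real.integral_rpow_mul_exp_neg_mul_Ioi (by positivity) one_pos]
  simp

end Polar

/-- The density, as a function of `q = ‖z‖`, of the image on `ℝ^m` of the measure
`‖ζ - a‖ ^ (-(m + 1)) dζ` on the hemisphere opposite to `a` under gnomonic projection. -/
noncomputable def gnomonicDensity (m : ℕ) (q : ℝ) : ℝ :=
  (2 * (Real.sqrt (1 + q ^ 2) ^ 2 + Real.sqrt (1 + q ^ 2))) ^ (-((m : ℝ) + 1) / 2)

theorem gnomonicDensity_nonneg (m : ℕ) (q : ℝ) : 0 ≤ gnomonicDensity m q :=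
  Real.rpow_nonneg (by positivity) _

theorem integrable_gnomonicDensity (m : ℕ) :
    Integrable fun z : EuclideanSpace ℝ (Fin m) => gnomonicDensity m ‖z‖ := by
  have h := integrable_rpow_neg_one_add_norm_sq (E := EuclideanSpace ℝ (Fin m))
    (μ := volume) (r := (m : ℝ) + 1) (by simp)
  have hc : Continuous fun z : EuclideanSpace ℝ (Fin m) => gnomonicDensity m ‖z‖ := by
    refine Continuous.rpow_const (by fun_prop) fun z => Or.inl ?_
    positivity
  refine h.mono' hc.aestronglyMeasurable (ae_of_all _ fun z => ?_)
  rw [Real.norm_of_nonneg (gnomonicDensity_nonneg _ _)]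
  refine Real.rpow_le_rpow_of_nonpos (by positivity) ?_ (neg_half_succ_nonpos m)
  rw [Real.sq_sqrt (by positivity)]
  have := Real.sqrt_nonneg (1 + ‖z‖ ^ 2)
  nlinarith [sq_nonneg ‖z‖]

/-- The weight in the coordinates `(p, z) ↦ p • (z - a)`, with `p > 0` and `z` orthogonal to `a`:
the integral over `p` is a Gamma function. -/
theorem integral_hemisphereWeight_eq_integral_gnomonicDensity {m : ℕ}
    {a : EuclideanSpace ℝ (Fin (m + 1))} (ha : ‖a‖ = 1) :
    ∫ x, hemisphereWeight m (inner ℝ x a) ‖x‖ = Real.Gamma (m + 1) *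
      ∫ z : EuclideanSpace ℝ (Fin m), gnomonicDensity m ‖z‖ := by
  obtain ⟨Φ, hmp, hemb, hΦ⟩ := exists_measurePreserving_prod ha
  have hint := (hmp.integrable_comp_emb hemb).2 (integrable_hemisphereWeight (m := m) (by simp) a)
  simp only [Function.comp_def, (hΦ _).1, (hΦ _).2] at hint
  rw [← hmp.integral_comp hemb]
  simp only [(hΦ _).1, (hΦ _).2]
  rw [Measure.volume_eq_prod] at hint ⊢
  rw [integral_prod _ hint]
  set N : EuclideanSpace ℝ (Fin m) → ℝ := fun z => Real.sqrt (1 + ‖z‖ ^ 2) with hN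
  have hN0 : ∀ z, 0 < N z := fun z => Real.sqrt_pos.2 (by positivity)
  set G : ℝ → EuclideanSpace ℝ (Fin m) → ℝ := fun p z =>
    p ^ (((m : ℝ) + 1) - 1) * Real.exp (-(N z * p)) *
      (2 * (1 + 1 / N z)) ^ (-((m : ℝ) + 1) / 2) with hG
  -- the substitution `y = p • z` on the slice at height `p`
  have hslice : ∀ p ∈ Set.Ioi (0 : ℝ), ∫ y : EuclideanSpace ℝ (Fin m),
      hemisphereWeight m (-p) (Real.sqrt (p ^ 2 + ‖y‖ ^ 2)) = ∫ z, G p z := by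
    intro p hp
    have hp0 : (0 : ℝ) < p := hp
    have hsc := Measure.integral_comp_smul_of_nonneg (volume : Measure (EuclideanSpace ℝ (Fin m)))
      (fun y => hemisphereWeight m (-p) (Real.sqrt (p ^ 2 + ‖y‖ ^ 2))) p (hR := hp0.le)
    rw [finrank_euclideanSpace_fin, smul_eq_mul] at hsc
    rw [← mul_right_inj' (inv_ne_zero (pow_ne_zero m hp0.ne')), ← hsc, ← integral_const_mul]
    refine integral_congr_ae (ae_of_all _ fun z => ?_)
    have h1 : Real.sqrt (p ^ 2 + ‖p • z‖ ^ 2) = N z * p := by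
      rw [norm_smul, Real.norm_of_nonneg hp0.le,
        show p ^ 2 + (p * ‖z‖) ^ 2 = (1 + ‖z‖ ^ 2) * p ^ 2 by ring,
        Real.sqrt_mul (by positivity), Real.sqrt_sq hp0.le]
    have hmem : -p ∈ Set.Iio (0 : ℝ) := neg_neg_of_pos hp0
    have h2 : -p / (N z * p) = -(1 / N z) := by
      have := (hN0 z).ne'
      field_simp
    simp only [h1, hemisphereWeight, Set.indicator_of_mem hmem, hG, h2, sub_neg_eq_add]
    rw [add_sub_cancel_right, Real.rpow_natCast]
    have := pow_ne_zero m hp0.ne'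
    field_simp
  have hinner : ∀ z, ∫ p in Set.Ioi (0 : ℝ), G p z =
      Real.Gamma (m + 1) * gnomonicDensity m ‖z‖ := by
    intro z
    have hz := hN0 z
    simp only [hG]
    rw [integral_mul_const, Real.integral_rpow_mul_exp_neg_mul_Ioi (by positivity) hz]
    have hpow : (1 / N z) ^ ((m : ℝ) + 1) = (N z ^ 2) ^ (-((m : ℝ) + 1) / 2) := by
      rw [one_div, Real.inv_rpow hz.le, ← Real.rpow_neg hz.le, ← Real.rpow_natCast,
        ← Real.rpow_mul hz.le]
      congr 1
      push_cast
      ring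
    have : (N z ^ 2) ^ (-((m : ℝ) + 1) / 2) * (2 * (1 + 1 / N z)) ^ (-((m : ℝ) + 1) / 2) =
        gnomonicDensity m ‖z‖ := by
      rw [← Real.mul_rpow (by positivity) (by positivity), gnomonicDensity]
      congr 1
      change _ = 2 * (N z ^ 2 + N z)
      field_simp
    rw [hpow, mul_right_comm, this, mul_comm]
  have hGnn : ∀ p ∈ Set.Ioi (0 : ℝ), ∀ z, 0 ≤ G p z := fun p hp z => by
    have := hN0 z
    have hp' : (0 : ℝ) < p := hp
    simp only [hG]
    positivity
  have hGint : Integrable (Function.uncurry G)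
      ((volume.restrict (Set.Ioi (0 : ℝ))).prod volume) := by
    have hNm : Measurable fun q : ℝ × EuclideanSpace ℝ (Fin m) => N q.2 :=
      Continuous.measurable (by fun_prop)
    have hmeas : Measurable (Function.uncurry G) :=
      ((measurable_fst.pow_const _).mul (Real.measurable_exp.comp (hNm.mul measurable_fst).neg)).mul
        (((measurable_const.div hNm).const_add 1).const_mul 2 |>.pow_const _)
    refine (integrable_prod_iff' hmeas.aestronglyMeasurable).2 ⟨ae_of_all _ fun z => ?_, ?_⟩
    · have h : IntegrableOn (fun p : ℝ => p ^ (((m : ℝ) + 1) - 1) * Real.exp (-N z * p ^ (1 : ℝ)))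
          (Set.Ioi 0) := integrableOn_rpow_mul_exp_neg_mul_rpow (by
            have : (0 : ℝ) ≤ m := by positivity
            linarith) one_pos (hN0 z)
      simp only [Real.rpow_one, neg_mul] at h
      exact Integrable.mul_const (f := fun p : ℝ => p ^ (((m : ℝ) + 1) - 1) *
        Real.exp (-(N z * p))) h ((2 * (1 + 1 / N z)) ^ (-((m : ℝ) + 1) / 2))
    · refine ((integrable_gnomonicDensity m).const_mul (Real.Gamma (m + 1))).congr
        (ae_of_all _ fun z => ?_)
      simp only [← hinner z]
      exact setIntegral_congr_fun measurableSet_Ioi fun p hp =>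
        (Real.norm_of_nonneg (hGnn p hp z)).symm
  calc ∫ p : ℝ, ∫ y : EuclideanSpace ℝ (Fin m),
        hemisphereWeight m (-p) (Real.sqrt (p ^ 2 + ‖y‖ ^ 2))
      = ∫ p in Set.Ioi (0 : ℝ), ∫ y : EuclideanSpace ℝ (Fin m),
        hemisphereWeight m (-p) (Real.sqrt (p ^ 2 + ‖y‖ ^ 2)) := by
        refine (setIntegral_eq_integral_of_forall_compl_eq_zero fun p hp => ?_).symm
        have : -p ∉ Set.Iio (0 : ℝ) := by simpa using hp
        simp only [hemisphereWeight, Set.indicator_of_notMem this, integral_zero]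
    _ = ∫ p in Set.Ioi (0 : ℝ), ∫ z, G p z := setIntegral_congr_fun measurableSet_Ioi hslice
    _ = ∫ z, ∫ p in Set.Ioi (0 : ℝ), G p z := integral_integral_swap hGint
    _ = _ := by simp_rw [hinner, integral_const_mul]

/-- Change of variables by the gnomonic projection from the hemisphere opposite to `a` to `ℝ^m`.
It is obtained by integrating the same weight on `ℝ^(m+1)` in two ways, which avoids a Jacobian on
the sphere. -/
theorem integral_oppositeHemisphere_eq_integral_gnomonicDensity {m : ℕ}
    {a : EuclideanSpace ℝ (Fin (m + 1))} (ha : ‖a‖ = 1) :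
    ∫ ζ in oppositeHemisphere a, (‖(ζ : EuclideanSpace ℝ (Fin (m + 1))) - a‖ ^ (m + 1))⁻¹
        ∂(volume : Measure (EuclideanSpace ℝ (Fin (m + 1)))).toSphere =
      ∫ z : EuclideanSpace ℝ (Fin m), gnomonicDensity m ‖z‖ :=
  mul_left_cancel₀ (Real.Gamma_pos_of_pos (by positivity : (0 : ℝ) < m + 1)).ne'
    ((integral_hemisphereWeight_eq_integral_oppositeHemisphere (by simp) ha).symm.trans
      (integral_hemisphereWeight_eq_integral_gnomonicDensity ha))

end Gnomonic

/-! ### Euler's integral for the hypergeometric series -/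

section Hypergeometric

theorem continuousOn_one_sub_rpow_mul_one_add_rpow {x : ℝ} (hx : 0 ≤ x) (y : ℝ) :
    ContinuousOn (fun t : ℝ => (1 - t) ^ x * (1 + t) ^ y) (Set.Icc 0 1) := by
  refine ContinuousOn.mul ?_ ?_
  · exact (continuousOn_const.sub continuousOn_id).rpow_const fun _ _ => Or.inr hx
  · refine (continuousOn_const.add continuousOn_id).rpow_const fun t ht => Or.inl ?_
    exact (by linarith [ht.1] : (0 : ℝ) < 1 + t).ne'

theorem intervalIntegrable_one_sub_rpow_mul_one_add_rpow {x : ℝ} (hx : 0 ≤ x) (y : ℝ) :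
    IntervalIntegrable (fun t : ℝ => (1 - t) ^ x * (1 + t) ^ y) volume 0 1 := by
  refine ContinuousOn.intervalIntegrable ?_
  rw [Set.uIcc_of_le zero_le_one]
  exact continuousOn_one_sub_rpow_mul_one_add_rpow hx y

theorem integral_one_sub_rpow_mul_one_add_rpow_nonneg (x y : ℝ) :
    0 ≤ ∫ t in (0 : ℝ)..1, (1 - t) ^ x * (1 + t) ^ y :=
  intervalIntegral.integral_nonneg zero_le_one fun t ht =>
    mul_nonneg (Real.rpow_nonneg (by linarith [ht.2]) _) (Real.rpow_nonneg (by linarith [ht.1]) _)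

theorem hasDerivAt_one_add_rpow {t : ℝ} (ht : 0 ≤ t) (y : ℝ) :
    HasDerivAt (fun t : ℝ => (1 + t) ^ y) (y * (1 + t) ^ (y - 1)) t := by
  have := ((hasDerivAt_id t).const_add 1).rpow_const (p := y)
    (Or.inl (by simp only [id]; linarith))
  convert! this using 1
  simp

theorem hasDerivAt_one_sub_rpow {t x : ℝ} (ht : 1 - t ≠ 0 ∨ 1 ≤ x) :
    HasDerivAt (fun t : ℝ => (1 - t) ^ x) (-(x * (1 - t) ^ (x - 1))) t := by
  have := ((hasDerivAt_id t).const_sub 1).rpow_const (p := x) (by simpa using ht)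
  convert! this using 1
  simp

/-- Integration by parts; iterated, it generates the hypergeometric series. -/
theorem add_one_mul_integral_one_sub_rpow {x : ℝ} (hx : 0 ≤ x) (y : ℝ) :
    (x + 1) * ∫ t in (0 : ℝ)..1, (1 - t) ^ x * (1 + t) ^ (-y) =
      1 - y * ∫ t in (0 : ℝ)..1, (1 - t) ^ (x + 1) * (1 + t) ^ (-(y + 1)) := by
  have h1 := (intervalIntegrable_one_sub_rpow_mul_one_add_rpow hx (-y)).const_mul (x + 1)
  have h2 := (intervalIntegrable_one_sub_rpow_mul_one_add_rpow
    (by linarith : 0 ≤ x + 1) (-(y + 1))).const_mul y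
  have hFTC := intervalIntegral.integral_eq_sub_of_hasDerivAt (a := 0) (b := 1)
    (f := fun t : ℝ => -((1 - t) ^ (x + 1) * (1 + t) ^ (-y)))
    (f' := fun t : ℝ => (x + 1) * ((1 - t) ^ x * (1 + t) ^ (-y))
      + y * ((1 - t) ^ (x + 1) * (1 + t) ^ (-(y + 1)))) (fun t ht => by
        rw [Set.uIcc_of_le zero_le_one] at ht
        have e1 := hasDerivAt_one_sub_rpow (t := t) (x := x + 1) (Or.inr (by linarith))
        have e2 := hasDerivAt_one_add_rpow ht.1 (-y)
        convert! (e1.mul e2).neg using 1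
        rw [add_sub_cancel_right, show -y - 1 = -(y + 1) by ring]
        ring) (h1.add h2)
  rw [intervalIntegral.integral_add h1 h2, intervalIntegral.integral_const_mul,
    intervalIntegral.integral_const_mul] at hFTC
  have h0 : (0 : ℝ) ^ (x + 1) = 0 := Real.zero_rpow (by linarith)
  simp [h0, -neg_add_rev] at hFTC
  linarith

/-- The absolute values of the terms of `₂F₁[1/2, 1; c; -1]`. -/
noncomputable def halfPochhammerRatio (c : ℝ) (k : ℕ) : ℝ :=
  (ascPochhammer ℝ k).eval (1 / 2) / (ascPochhammer ℝ k).eval c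

theorem halfPochhammerRatio_pos {c : ℝ} (hc : 0 < c) (k : ℕ) : 0 < halfPochhammerRatio c k :=
  div_pos (ascPochhammer_pos k _ (by norm_num)) (ascPochhammer_pos k _ hc)

theorem halfPochhammerRatio_succ {c : ℝ} (hc : 0 < c) (k : ℕ) :
    (c + k) * halfPochhammerRatio c (k + 1) = (1 / 2 + k) * halfPochhammerRatio c k := by
  have h1 := (ascPochhammer_pos k c hc).ne'
  have h2 : c + k ≠ 0 := by positivity
  simp only [halfPochhammerRatio, ascPochhammer_succ_eval]
  field_simp

/-- The partial sums telescope. -/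
theorem sum_halfPochhammerRatio {c : ℝ} (hc : 0 < c) (N : ℕ) :
    (c - 3 / 2) * ∑ k ∈ Finset.range N, halfPochhammerRatio c k =
      c - 1 - (c - 1 + N) * halfPochhammerRatio c N := by
  induction N with
  | zero => simp [halfPochhammerRatio]
  | succ N ih =>
    rw [Finset.sum_range_succ, mul_add, ih]
    have := halfPochhammerRatio_succ hc N
    push_cast
    linear_combination this

theorem summable_halfPochhammerRatio {c : ℝ} (hc : 3 / 2 < c) :
    Summable (halfPochhammerRatio c) := by
  have hc0 : 0 < c := by linarith
  refine summable_of_sum_range_le (c := (c - 1) / (c - 3 / 2))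
    (fun k => (halfPochhammerRatio_pos hc0 k).le) fun N => ?_
  rw [le_div_iff₀ (by linarith), mul_comm, sum_halfPochhammerRatio hc0]
  have h1 := halfPochhammerRatio_pos hc0 N
  have h2 : 0 ≤ c - 1 + N := by
    have : (0 : ℝ) ≤ N := by positivity
    linarith
  nlinarith [mul_nonneg h2 h1.le]

/-- Euler's integral for `₂F₁[1/2, 1; β + 2; -1]`; repeated integration by parts produces
the series. -/
theorem ordinaryHypergeometric_half_one_neg_one {β : ℝ} (hβ : 0 ≤ β) :
    ordinaryHypergeometric (1 / 2 : ℝ) (1 : ℝ) (β + 2) (-1 : ℝ) =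
      (β + 1) * ∫ t in (0 : ℝ)..1, (1 - t) ^ β * (1 + t) ^ (-(1 / 2) : ℝ) := by
  have hc : (0 : ℝ) < β + 2 := by linarith
  set F : ℕ → ℝ := fun k => ∫ t in (0 : ℝ)..1, (1 - t) ^ (β + k) * (1 + t) ^ (-(1 / 2 + k) : ℝ)
    with hF
  have hrec : ∀ k, (β + 1 + k) * F k = 1 - (1 / 2 + k) * F (k + 1) := by
    intro k
    have := add_one_mul_integral_one_sub_rpow (x := β + k) (by positivity) (1 / 2 + k)
    simp only [hF]
    push_cast
    rw [show β + 1 + k = β + k + 1 by ring, show β + ((k : ℝ) + 1) = β + k + 1 by ring,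
      show (1 / 2 : ℝ) + ((k : ℝ) + 1) = 1 / 2 + k + 1 by ring]
    exact this
  have hF0 : ∀ k, 0 ≤ F k := fun k => integral_one_sub_rpow_mul_one_add_rpow_nonneg _ _
  have hpartial : ∀ N : ℕ, (β + 1) * F 0 =
      ∑ k ∈ Finset.range N, (-1) ^ k * halfPochhammerRatio (β + 2) k
        + (-1) ^ N * halfPochhammerRatio (β + 2) N * ((β + 1 + N) * F N) := by
    intro N
    induction N with
    | zero => simp [halfPochhammerRatio]
    | succ N ih =>
      rw [ih, Finset.sum_range_succ, hrec N]
      have := halfPochhammerRatio_succ hc N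
      push_cast
      rw [pow_succ]
      linear_combination ((-1) ^ N * F (N + 1)) * this
  have hsum := summable_halfPochhammerRatio (c := β + 2) (by linarith)
  have hrem : Tendsto (fun N : ℕ => (-1) ^ N * halfPochhammerRatio (β + 2) N
      * ((β + 1 + N) * F N)) atTop (𝓝 0) := by
    refine squeeze_zero_norm (fun N => ?_) hsum.tendsto_atTop_zero
    have h1 := halfPochhammerRatio_pos hc N
    have h2 : 0 ≤ (β + 1 + N) * F N := mul_nonneg (by positivity) (hF0 N)
    have h3 : (β + 1 + N) * F N ≤ 1 := by
      rw [hrec N]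
      have : 0 ≤ (1 / 2 + (N : ℝ)) * F (N + 1) := mul_nonneg (by positivity) (hF0 _)
      linarith
    rw [norm_mul, norm_mul, norm_pow, norm_neg, norm_one, one_pow, one_mul,
      Real.norm_of_nonneg h1.le, Real.norm_of_nonneg h2]
    exact mul_le_of_le_one_right h1.le h3
  have hsum' : Summable fun k => (-1) ^ k * halfPochhammerRatio (β + 2) k := by
    refine Summable.of_norm (hsum.congr fun k => ?_)
    simp [abs_of_pos (halfPochhammerRatio_pos hc k)]
  have hlim : Tendsto (fun N => ∑ k ∈ Finset.range N, (-1) ^ k * halfPochhammerRatio (β + 2) k)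
      atTop (𝓝 ((β + 1) * F 0)) := by
    have h : (fun N => ∑ k ∈ Finset.range N, (-1) ^ k * halfPochhammerRatio (β + 2) k) =
        fun N : ℕ => (β + 1) * F 0 -
          (-1) ^ N * halfPochhammerRatio (β + 2) N * ((β + 1 + N) * F N) := by
      ext N
      rw [hpartial N]
      ring
    rw [h]
    simpa using hrem.const_sub ((β + 1) * F 0)
  have htsum := tendsto_nhds_unique hsum'.hasSum.tendsto_sum_nat hlim
  rw [ordinaryHypergeometric_eq_tsum]
  simp only [hF, Nat.cast_zero, add_zero] at htsum
  rw [← htsum]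
  refine tsum_congr fun k => ?_
  have hk : (k ! : ℝ) ≠ 0 := by positivity
  rw [ascPochhammer_eval_one, smul_eq_mul, halfPochhammerRatio]
  field_simp

end Hypergeometric

/-! ### Reduction of the hemisphere integral to Euler integrals -/

section HemisphereConstant

/-- A contiguous relation, with `₂F₁` replaced by Euler integrals. The combination of integrands on
the left is the derivative of
`-(1 - t) ^ β * (1 + t) ^ (-1/2) * (8 * β + (2 - 4 * β) * (1 + t))`. -/
theorem mul_integral_add_mul_integral_eq {β : ℝ} (hβ : 0 < β) :
    8 * β * (∫ t in (0 : ℝ)..1, (1 - t) ^ (β - 1) * (1 + t) ^ (-(3 / 2) : ℝ)) +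
      (4 * β ^ 2 - 1) * (∫ t in (0 : ℝ)..1, (1 - t) ^ β * (1 + t) ^ (-(1 / 2) : ℝ)) =
        4 * β + 2 := by
  have hJ : IntervalIntegrable (fun t : ℝ => (1 - t) ^ (β - 1) * (1 + t) ^ (-(3 / 2) : ℝ))
      volume 0 1 := by
    have h := (intervalIntegral.intervalIntegrable_rpow' (a := 0) (b := 1) (r := β - 1)
      (by linarith)).comp_sub_left 1
    simp only [sub_zero, sub_self] at h
    refine h.symm.mul_continuousOn ?_
    rw [Set.uIcc_of_le zero_le_one]
    refine (continuousOn_const.add continuousOn_id).rpow_const fun t ht => Or.inl ?_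
    exact (by linarith [ht.1] : (0 : ℝ) < 1 + t).ne'
  have h1 := hJ.const_mul (8 * β)
  have h2 := (intervalIntegrable_one_sub_rpow_mul_one_add_rpow hβ.le (-(1 / 2))).const_mul
    (4 * β ^ 2 - 1)
  have hFTC := intervalIntegral.integral_eq_sub_of_hasDerivAt_of_le zero_le_one
    (f := fun t : ℝ => -(((1 - t) ^ β * (1 + t) ^ (-(1 / 2) : ℝ)) *
      (8 * β + (2 - 4 * β) * (1 + t))))
    (f' := fun t : ℝ => 8 * β * ((1 - t) ^ (β - 1) * (1 + t) ^ (-(3 / 2) : ℝ))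
      + (4 * β ^ 2 - 1) * ((1 - t) ^ β * (1 + t) ^ (-(1 / 2) : ℝ)))
    (((continuousOn_one_sub_rpow_mul_one_add_rpow hβ.le _).mul
      (Continuous.continuousOn (by fun_prop))).neg) (fun t ht => by
        have e1 := hasDerivAt_one_sub_rpow (t := t) (x := β) (Or.inl (by linarith [ht.2]))
        have e2 := hasDerivAt_one_add_rpow ht.1.le (-(1 / 2))
        have e3 : HasDerivAt (fun t : ℝ => 8 * β + (2 - 4 * β) * (1 + t)) (2 - 4 * β) t := by
          simpa using ((((hasDerivAt_id t).const_add 1).const_mul (2 - 4 * β)).const_add (8 * β))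
        convert! ((e1.mul e2).mul e3).neg using 1
        have ht1 : 0 < 1 - t := by linarith [ht.2]
        have ht2 : 0 < 1 + t := by linarith [ht.1]
        have r1 : (1 - t) ^ β = (1 - t) * (1 - t) ^ (β - 1) := by
          rw [Real.rpow_sub_one ht1.ne']; field_simp
        have r2 : (1 + t) ^ (-(1 / 2) : ℝ) = (1 + t) * (1 + t) ^ (-(3 / 2) : ℝ) := by
          rw [show (-(3 / 2) : ℝ) = -(1 / 2) - 1 by norm_num, Real.rpow_sub_one ht2.ne']
          field_simp
        rw [Pi.mul_apply, r1, r2, show (-(1 / 2) - 1 : ℝ) = -(3 / 2) by norm_num]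
        ring) (h1.add h2)
  rw [intervalIntegral.integral_add h1 h2, intervalIntegral.integral_const_mul,
    intervalIntegral.integral_const_mul] at hFTC
  rw [hFTC]
  simp [Real.zero_rpow hβ.ne']
  ring

/-- The substitution `t = 1 / √(1 + y²)`. -/
theorem integral_Ioi_pow_mul_gnomonicDensity (m : ℕ) :
    ∫ y in Set.Ioi (0 : ℝ), y ^ m * gnomonicDensity (m + 1) y =
      2 ^ (-((m : ℝ) + 2) / 2) *
        ∫ t in (0 : ℝ)..1, (1 - t) ^ (((m : ℝ) + 1) / 2 - 1) * (1 + t) ^ (-(3 / 2) : ℝ) := by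
  set f : ℝ → ℝ := fun t => Real.sqrt (1 - t ^ 2) / t with hf
  have hpos : ∀ t ∈ Set.Ioo (0 : ℝ) 1, 0 < 1 - t ^ 2 := fun t ht => by nlinarith [ht.1, ht.2]
  have hinv : ∀ t ∈ Set.Ioo (0 : ℝ) 1, Real.sqrt (1 + f t ^ 2) = 1 / t := by
    intro t ht
    have ht0 := ht.1
    rw [hf, div_pow, Real.sq_sqrt (hpos t ht).le,
      show 1 + (1 - t ^ 2) / t ^ 2 = (1 / t) ^ 2 by field_simp; ring,
      Real.sqrt_sq (by positivity)]
  have hinj : Set.InjOn f (Set.Ioo 0 1) := by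
    intro s hs t ht hst
    have h1 := hinv s hs
    rw [hst, hinv t ht] at h1
    simpa using h1.symm
  have himage : f '' Set.Ioo 0 1 = Set.Ioi 0 := by
    ext y
    constructor
    · rintro ⟨t, ht, rfl⟩
      exact div_pos (Real.sqrt_pos.2 (hpos t ht)) ht.1
    · intro hy
      have hy0 : (0 : ℝ) < y := hy
      have hs1 : 1 < Real.sqrt (1 + y ^ 2) := by
        rw [Real.lt_sqrt zero_le_one]; nlinarith
      have hsq : Real.sqrt (1 + y ^ 2) ^ 2 = 1 + y ^ 2 := Real.sq_sqrt (by positivity)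
      have hs0 : 0 < Real.sqrt (1 + y ^ 2) := by linarith
      refine ⟨1 / Real.sqrt (1 + y ^ 2), ⟨by positivity, (div_lt_one hs0).2 hs1⟩, ?_⟩
      simp only [hf]
      rw [div_pow, hsq, show (1 : ℝ) - 1 ^ 2 / (1 + y ^ 2) = y ^ 2 / (1 + y ^ 2) by
        field_simp; ring, Real.sqrt_div (by positivity), Real.sqrt_sq hy0.le]
      field_simp
  have hder : ∀ t ∈ Set.Ioo (0 : ℝ) 1,
      HasDerivWithinAt f (-(1 / (t ^ 2 * Real.sqrt (1 - t ^ 2)))) (Set.Ioo 0 1) t := by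
    intro t ht
    have h1 : HasDerivAt (fun t : ℝ => 1 - t ^ 2) (-(2 * t)) t := by
      simpa using (hasDerivAt_pow 2 t).const_sub 1
    have h2 := (h1.sqrt (hpos t ht).ne').div (hasDerivAt_id t) ht.1.ne'
    refine HasDerivAt.hasDerivWithinAt ?_
    convert! h2 using 1
    have hs := Real.sqrt_pos.2 (hpos t ht)
    have hsq := Real.sq_sqrt (hpos t ht).le
    have ht0 := ht.1.ne'
    simp only [id]
    field_simp
    rw [hsq]
    ring
  rw [← himage, integral_image_eq_integral_abs_deriv_smul measurableSet_Ioo hder hinj,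
    intervalIntegral.integral_of_le zero_le_one, integral_Ioc_eq_integral_Ioo,
    ← integral_const_mul]
  refine setIntegral_congr_fun measurableSet_Ioo fun t ht => ?_
  have ht0 := ht.1
  have ht1 : 0 < 1 - t := by linarith [ht.2]
  have ht2 : 0 < 1 + t := by linarith
  have hs : Real.sqrt (1 - t ^ 2) = (1 - t) ^ (1 / 2 : ℝ) * (1 + t) ^ (1 / 2 : ℝ) := by
    rw [Real.sqrt_eq_rpow, ← Real.mul_rpow ht1.le ht2.le]
    congr 1; ring
  have hsp := Real.sqrt_pos.2 (hpos t ht)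
  have hdens : gnomonicDensity (m + 1) (f t) =
      2 ^ (-((m : ℝ) + 2) / 2) * (1 + t) ^ (-((m : ℝ) + 2) / 2) * t ^ (m + 2) := by
    rw [gnomonicDensity, hinv t ht,
      show 2 * ((1 / t) ^ 2 + 1 / t) = 2 * (1 + t) * (t ^ 2)⁻¹ by field_simp,
      Real.mul_rpow (by positivity) (by positivity), Real.mul_rpow (by positivity) ht2.le,
      Real.inv_rpow (by positivity), ← Real.rpow_neg (by positivity), ← Real.rpow_natCast t 2,
      ← Real.rpow_mul ht0.le, ← Real.rpow_natCast t (m + 2)]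
    push_cast
    congr 2
    · congr 1; ring
    · congr 1; ring
    · ring
  simp only [smul_eq_mul]
  rw [hdens, abs_neg, abs_of_pos (by positivity), hf, div_pow]
  have hS : Real.sqrt (1 - t ^ 2) ^ m * (Real.sqrt (1 - t ^ 2))⁻¹ =
      (1 - t) ^ (((m : ℝ) + 1) / 2 - 1) * (1 + t) ^ (((m : ℝ) + 1) / 2 - 1) := by
    rw [← Real.rpow_natCast, ← Real.rpow_neg_one, ← Real.rpow_add hsp, hs,
      Real.mul_rpow (by positivity) (by positivity), ← Real.rpow_mul ht1.le,
      ← Real.rpow_mul ht2.le]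
    congr 2 <;> ring
  have hT : (1 + t) ^ (((m : ℝ) + 1) / 2 - 1) * (1 + t) ^ (-((m : ℝ) + 2) / 2) =
      (1 + t) ^ (-(3 / 2) : ℝ) := by
    rw [← Real.rpow_add ht2]
    congr 1; ring
  rw [← hT]
  calc _ = 2 ^ (-((m : ℝ) + 2) / 2) * (1 + t) ^ (-((m : ℝ) + 2) / 2) *
        (Real.sqrt (1 - t ^ 2) ^ m * (Real.sqrt (1 - t ^ 2))⁻¹) := by
        field_simp
        ring
    _ = _ := by rw [hS]; ring

end HemisphereConstant

/-! ### Evaluation of the constant -/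

section KalajConstant

/-- The constant with Euler's integral in place of the hypergeometric series. -/
theorem kalajConstant_succ (m : ℕ) :
    kalajConstant (m + 1) = ((m + 1)! : ℕ) * (m + 2 - ((m : ℝ) - 1) * (((m : ℝ) / 2 + 1) *
      ∫ t in (0 : ℝ)..1, (1 - t) ^ ((m : ℝ) / 2) * (1 + t) ^ (-(1 / 2) : ℝ))) /
      ((2 : ℝ) ^ (3 * ((m : ℝ) + 1) / 2) * Real.Gamma ((m : ℝ) / 2 + 1) *
        (((m : ℝ) / 2 + 1) * Real.Gamma ((m : ℝ) / 2 + 1))) := by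
  have h0 : (0 : ℝ) ≤ (m : ℝ) / 2 := by positivity
  rw [← ordinaryHypergeometric_half_one_neg_one h0, ← Real.Gamma_add_one (by positivity),
    kalajConstant]
  push_cast
  rw [show (1 + ((m : ℝ) + 1)) / 2 = m / 2 + 1 by ring,
    show (3 + ((m : ℝ) + 1)) / 2 = m / 2 + 2 by ring,
    show (m : ℝ) / 2 + 1 + 1 = m / 2 + 2 by ring,
    show 1 + ((m : ℝ) + 1) = m + 2 by ring, show (m : ℝ) + 1 - 2 = m - 1 by ring]

theorem kalajConstant_one : kalajConstant 1 = 1 := by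
  have hE : ∫ t in (0 : ℝ)..1, (1 - t) ^ ((0 : ℝ) / 2) * (1 + t) ^ (-(1 / 2) : ℝ) =
      2 * Real.sqrt 2 - 2 := by
    have h := intervalIntegral.integral_eq_sub_of_hasDerivAt (a := 0) (b := 1)
      (f := fun t : ℝ => 2 * (1 + t) ^ (1 / 2 : ℝ))
      (f' := fun t : ℝ => (1 - t) ^ ((0 : ℝ) / 2) * (1 + t) ^ (-(1 / 2) : ℝ)) (fun t ht => by
        rw [Set.uIcc_of_le zero_le_one] at ht
        convert! (hasDerivAt_one_add_rpow ht.1 (1 / 2)).const_mul 2 using 1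
        norm_num
        ring)
      (intervalIntegrable_one_sub_rpow_mul_one_add_rpow (by norm_num) _)
    rw [h, Real.sqrt_eq_rpow]
    norm_num
  have h := kalajConstant_succ 0
  simp only [Nat.cast_zero] at h
  rw [hE] at h
  have h2 : (2 : ℝ) ^ (3 * ((0 : ℝ) + 1) / 2) = 2 * Real.sqrt 2 := by
    rw [show 3 * ((0 : ℝ) + 1) / 2 = 1 + 1 / 2 by norm_num, Real.rpow_add two_pos,
      Real.rpow_one, ← Real.sqrt_eq_rpow]
  rw [h2] at h
  simpa using h

theorem kalajConstant_two : kalajConstant 2 = 2 / Real.pi := by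
  have hG1 : Real.Gamma (3 / 2) = Real.sqrt Real.pi / 2 := by
    rw [show (3 / 2 : ℝ) = 1 / 2 + 1 by norm_num, Real.Gamma_add_one (by norm_num),
      Real.Gamma_one_half_eq]
    ring
  have hG2 : Real.Gamma (5 / 2) = 3 / 4 * Real.sqrt Real.pi := by
    rw [show (5 / 2 : ℝ) = 3 / 2 + 1 by norm_num, Real.Gamma_add_one (by norm_num), hG1]
    ring
  have hsq : Real.sqrt Real.pi * Real.sqrt Real.pi = Real.pi := Real.mul_self_sqrt Real.pi_pos.le
  rw [kalajConstant]
  norm_num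
  rw [hG1, hG2, show 8 * (Real.sqrt Real.pi / 2) * (3 / 4 * Real.sqrt Real.pi) =
    3 * (Real.sqrt Real.pi * Real.sqrt Real.pi) by ring, hsq]
  have := Real.pi_pos
  field_simp
  norm_num

theorem toSphere_euclideanSpace_real_univ (m : ℕ) :
    (volume : Measure (EuclideanSpace ℝ (Fin (m + 1)))).toSphere.real Set.univ =
      (m + 1) * (Real.sqrt Real.pi ^ (m + 1) / Real.Gamma (((m : ℝ) + 1) / 2 + 1)) := by
  rw [Measure.toSphere_real_apply_univ, finrank_euclideanSpace_fin, Measure.real,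
    EuclideanSpace.volume_ball, ENNReal.ofReal_one, one_pow, one_mul, ENNReal.toReal_ofReal]
  · simp
  · have : 0 < Real.Gamma ((Fintype.card (Fin (m + 1)) : ℝ) / 2 + 1) :=
      Real.Gamma_pos_of_pos (by positivity)
    positivity

/-- The constant is `4` times the mean of `‖ζ - a‖ ^ (-n)` over the sphere, `ζ` restricted to the
hemisphere opposite to `a`. -/
theorem four_mul_integral_oppositeHemisphere {m : ℕ} {a : EuclideanSpace ℝ (Fin (m + 1))}
    (ha : ‖a‖ = 1) :
    4 * ∫ ζ in oppositeHemisphere a, (‖(ζ : EuclideanSpace ℝ (Fin (m + 1))) - a‖ ^ (m + 1))⁻¹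
        ∂(volume : Measure (EuclideanSpace ℝ (Fin (m + 1)))).toSphere =
      (volume : Measure (EuclideanSpace ℝ (Fin (m + 1)))).toSphere.real Set.univ *
        kalajConstant (m + 1) := by
  rw [integral_oppositeHemisphere_eq_integral_gnomonicDensity ha,
    toSphere_euclideanSpace_real_univ]
  have hsπ : 0 < Real.sqrt Real.pi := Real.sqrt_pos.2 Real.pi_pos
  -- `ℝ⁰` is a point, and polar coordinates are available in the other dimensions
  rcases m with _ | k
  · have hvol : (volume : Measure (EuclideanSpace ℝ (Fin 0))).real Set.univ = 1 := by
      have h := (PiLp.volume_preserving_toLp (Fin 0)).measure_preimage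
        MeasurableSet.univ.nullMeasurableSet
      rw [Measure.real, ← h, Set.preimage_univ, volume_pi, Measure.pi_of_empty]
      simp
    have hint : ∫ z : EuclideanSpace ℝ (Fin 0), gnomonicDensity 0 ‖z‖ = 1 / 2 := by
      have : ∀ z : EuclideanSpace ℝ (Fin 0), gnomonicDensity 0 ‖z‖ = 1 / 2 := fun z => by
        rw [Subsingleton.elim z 0, gnomonicDensity]
        norm_num
      simp_rw [this]
      rw [integral_const, hvol]
      simp
    have hG : Real.Gamma (1 / 2 + 1) = Real.sqrt Real.pi / 2 := by
      rw [Real.Gamma_add_one (by norm_num), Real.Gamma_one_half_eq]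
      ring
    simp only [zero_add, Nat.cast_zero]
    rw [hint, kalajConstant_one, hG]
    field_simp
    norm_num
  · have hradial := integral_fun_norm_addHaar
      (volume : Measure (EuclideanSpace ℝ (Fin (k + 1)))) (gnomonicDensity (k + 1))
    rw [finrank_euclideanSpace_fin, ← smul_assoc, nsmul_eq_mul] at hradial
    have hS := toSphere_euclideanSpace_real_univ k
    rw [Measure.toSphere_real_apply_univ, finrank_euclideanSpace_fin] at hS
    rw [hS] at hradial
    simp only [Nat.add_sub_cancel, smul_eq_mul] at hradial
    rw [integral_Ioi_pow_mul_gnomonicDensity] at hradial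
    rw [hradial, kalajConstant_succ]
    have hβ : (0 : ℝ) < ((k : ℝ) + 1) / 2 := by positivity
    have hcont := mul_integral_add_mul_integral_eq hβ
    push_cast
    set J := ∫ t in (0 : ℝ)..1, (1 - t) ^ (((k : ℝ) + 1) / 2 - 1) * (1 + t) ^ (-(3 / 2) : ℝ)
    set I := ∫ t in (0 : ℝ)..1, (1 - t) ^ (((k : ℝ) + 1) / 2) * (1 + t) ^ (-(1 / 2) : ℝ)
    -- the duplication formula expresses the factorial through the Gamma values in both sides
    have hdup := Real.Gamma_mul_Gamma_add_half (((k : ℝ) + 2) / 2)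
    rw [show ((k : ℝ) + 2) / 2 + 1 / 2 = (k + 1) / 2 + 1 by ring,
      show 2 * (((k : ℝ) + 2) / 2) = ((k + 1 : ℕ) : ℝ) + 1 by push_cast; ring,
      Real.Gamma_nat_eq_factorial] at hdup
    have hG1 : Real.Gamma (((k : ℝ) + 1 + 1) / 2 + 1) =
        ((k : ℝ) + 2) / 2 * Real.Gamma (((k : ℝ) + 2) / 2) := by
      rw [← Real.Gamma_add_one (by positivity)]
      congr 1; ring
    rw [hG1, Nat.factorial_succ (k + 1)]
    have hp1 : (2 : ℝ) ^ (1 - (((k + 1 : ℕ) : ℝ) + 1)) = (2 ^ (k + 1))⁻¹ := by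
      rw [← Real.rpow_natCast, ← Real.rpow_neg two_pos.le]
      congr 1; ring
    have hp2 : (2 : ℝ) ^ (3 * ((k : ℝ) + 1 + 1) / 2) =
        2 ^ (k + 2) * (2 ^ (-((k : ℝ) + 2) / 2))⁻¹ := by
      rw [← Real.rpow_natCast, ← Real.rpow_neg two_pos.le, ← Real.rpow_add two_pos]
      congr 1; push_cast; ring
    rw [hp1] at hdup
    rw [hp2]
    set A := Real.Gamma (((k : ℝ) + 2) / 2)
    set B := Real.Gamma (((k : ℝ) + 1) / 2 + 1)
    have hA : 0 < A := Real.Gamma_pos_of_pos (by positivity)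
    have hB : 0 < B := Real.Gamma_pos_of_pos (by positivity)
    set p := (2 : ℝ) ^ (-((k : ℝ) + 2) / 2)
    have hp : 0 < p := Real.rpow_pos_of_pos two_pos _
    push_cast
    -- the bracket in the constant, evaluated by the contiguous relation
    have hbr : (k : ℝ) + 1 + 2 - ((k : ℝ) + 1 - 1) * ((((k : ℝ) + 1) / 2 + 1) * I) =
        2 * (k + 1) * (k + 3) / (k + 2) * J := by
      field_simp
      linear_combination (-((k : ℝ) + 3)) * hcont
    rw [hbr]
    have hfac : (((k + 1)! : ℕ) : ℝ) = A * B * 2 ^ (k + 1) / Real.sqrt Real.pi := by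
      rw [hdup]; field_simp
    rw [hfac]
    field_simp
    ring

theorem kalajConstant_succ_pos (m : ℕ) : 0 < kalajConstant (m + 1) := by
  set a : EuclideanSpace ℝ (Fin (m + 1)) := EuclideanSpace.single 0 1
  have ha : ‖a‖ = 1 := by simp [a]
  have h := four_mul_integral_oppositeHemisphere ha
  rw [integral_oppositeHemisphere_eq_integral_gnomonicDensity ha] at h
  have hpos : 0 < ∫ z : EuclideanSpace ℝ (Fin m), gnomonicDensity m ‖z‖ := by
    rw [integral_pos_iff_support_of_nonneg (fun z => gnomonicDensity_nonneg _ _)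
      (integrable_gnomonicDensity m)]
    have : Function.support (fun z : EuclideanSpace ℝ (Fin m) => gnomonicDensity m ‖z‖) =
        Set.univ := by
      refine Set.eq_univ_of_forall fun z => (Real.rpow_pos_of_pos ?_ _).ne'
      positivity
    rw [this]
    exact isOpen_univ.measure_pos _ Set.univ_nonempty
  refine pos_of_mul_pos_right (a := (volume : Measure
    (EuclideanSpace ℝ (Fin (m + 1)))).toSphere.real Set.univ) ?_ measureReal_nonneg
  rw [← h]
  positivity

end KalajConstant

/-! ### The boundary Schwarz lemma -/

section BoundarySchwarz

variable {H : Type*} [NormedAddCommGroup H] [InnerProductSpace ℝ H] {n : ℕ}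
  {f : EuclideanSpace ℝ (Fin n) → H} {a : EuclideanSpace ℝ (Fin n)} {b : H}

theorem IsBoundarySchwarzMap.exists_eq_succ (h : IsBoundarySchwarzMap f a b) :
    ∃ m, n = m + 1 := by
  refine Nat.exists_eq_succ_of_ne_zero ?_
  rintro rfl
  have := h.norm_point
  rw [Subsingleton.elim a 0, norm_zero] at this
  exact zero_ne_one this

theorem IsBoundarySchwarzMap.abs_inner_lt (h : IsBoundarySchwarzMap f a b)
    {x : EuclideanSpace ℝ (Fin n)} (hx : x ∈ ball 0 1) : |inner ℝ b (f x)| < 1 := by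
  have h1 := abs_real_inner_le_norm b (f x)
  have h2 := h.mapsTo hx
  rw [mem_ball_zero_iff] at h2
  rw [h.norm_value, one_mul] at h1
  exact h1.trans_lt h2

/-- The boundary Schwarz estimate along the radius ending at `a`: the lower bound for
`1 - ⟪b, f⟫`. -/
theorem IsBoundarySchwarzMap.one_sub_inner_ge (h : IsBoundarySchwarzMap f a b) {ρ : ℝ}
    (hρ : ρ ∈ Set.Ioo (0 : ℝ) 1) :
    (1 - ρ ^ 2) / 2 * kalajConstant n ≤ 1 - inner ℝ b (f (ρ • a)) := by
  obtain ⟨m, rfl⟩ := h.exists_eq_succ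
  set w : EuclideanSpace ℝ (Fin (m + 1)) → ℝ := (fun _ => (1 : ℝ)) - (innerSL ℝ b) ∘ f
  have hw : HarmonicOnNhd w (ball 0 1) :=
    (harmonicOnNhd_const 1).sub (h.harmonic.comp_CLM (innerSL ℝ b))
  have hval : ∀ x, w x = 1 - inner ℝ b (f x) := fun x => rfl
  have hlow := mul_integral_oppositeHemisphere_le hw
    (fun x hx => by rw [hval]; linarith [(abs_lt.1 (h.abs_inner_lt hx)).2])
    (fun x hx => by rw [hval]; linarith [(abs_lt.1 (h.abs_inner_lt hx)).1])
    (by rw [hval, h.map_zero, inner_zero_right, sub_zero]) h.norm_point hρ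
  have hK := four_mul_integral_oppositeHemisphere h.norm_point
  rw [finrank_euclideanSpace_fin] at hlow
  set s := (volume : Measure (EuclideanSpace ℝ (Fin (m + 1)))).toSphere.real Set.univ with hs
  have hs0 : 0 < s := by
    rw [hs, toSphere_euclideanSpace_real_univ]
    have := Real.Gamma_pos_of_pos (by positivity : (0 : ℝ) < ((m : ℝ) + 1) / 2 + 1)
    have := Real.sqrt_pos.2 Real.pi_pos
    positivity
  rw [hval] at hlow
  refine le_of_mul_le_mul_left ?_ hs0
  calc s * ((1 - ρ ^ 2) / 2 * kalajConstant (m + 1))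
      = (1 - ρ ^ 2) / 2 * (s * kalajConstant (m + 1)) := by ring
    _ ≤ _ := by rw [← hK]; linarith

theorem IsBoundarySchwarzMap.kalajConstant_pos (h : IsBoundarySchwarzMap f a b) :
    0 < kalajConstant n := by
  obtain ⟨m, rfl⟩ := h.exists_eq_succ
  exact kalajConstant_succ_pos m

theorem IsBoundarySchwarzMap.smul_mem_ball (h : IsBoundarySchwarzMap f a b) {t : ℝ}
    (ht0 : 0 ≤ t) (ht1 : t < 1) : t • a ∈ ball (0 : EuclideanSpace ℝ (Fin n)) 1 := by
  rw [mem_ball_zero_iff, norm_smul, h.norm_point, Real.norm_of_nonneg ht0, mul_one]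
  exact ht1

/-- The mean value theorem on `[r, 1]` gives points where the radial derivative is large. -/
theorem IsBoundarySchwarzMap.exists_le_norm_deriv (h : IsBoundarySchwarzMap f a b) {r : ℝ}
    (hr : r ∈ Set.Ioo (0 : ℝ) 1) :
    ∃ ξ ∈ Set.Ioo r 1, (1 + r) / 2 * kalajConstant n ≤ ‖deriv (fun t : ℝ => f (t • a)) ξ‖ := by
  set g : ℝ → H := fun t => f (t • a) with hg
  have hdiff : ∀ t ∈ Set.Ioo r 1, HasDerivAt g (deriv g t) t := by
    intro t ht
    have hf := (h.harmonic _ (h.smul_mem_ball (hr.1.trans ht.1).le ht.2)).1.differentiableAt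
      (by norm_num)
    have : DifferentiableAt ℝ g t :=
      hf.comp (f := fun t : ℝ => t • a) t (differentiableAt_id.smul_const a)
    exact this.hasDerivAt
  have hcont : ContinuousOn g (Set.Icc r 1) := by
    intro t ht
    rcases eq_or_lt_of_le ht.2 with rfl | ht1
    · -- at the endpoint only the values of `f` in the ball and at `a` are approached
      have hins : ContinuousWithinAt f (insert a (ball 0 1)) ((1 : ℝ) • a) := by
        rw [one_smul]
        exact h.continuous_at_point.insert
      refine hins.comp (t := insert a (ball 0 1)) (f := fun t : ℝ => t • a)
        (by fun_prop) fun t ht => ?_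
      rcases eq_or_lt_of_le ht.2 with rfl | ht1
      · exact Set.mem_insert_iff.2 (Or.inl (one_smul ℝ a))
      · exact Set.mem_insert_of_mem _ (h.smul_mem_ball (hr.1.le.trans ht.1) ht1)
    · have hf := (h.harmonic _ (h.smul_mem_ball (hr.1.le.trans ht.1) ht1)).1.continuousAt
      exact (hf.comp (f := fun t : ℝ => t • a) (by fun_prop)).continuousWithinAt
  obtain ⟨ξ, hξ, hslope⟩ := exists_hasDerivAt_eq_slope (fun t => inner ℝ b (g t))
    (fun t => inner ℝ b (deriv g t)) hr.2 (continuousOn_const.inner hcont)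
    fun t ht => by simpa using (hasDerivAt_const t b).inner ℝ (hdiff t ht)
  refine ⟨ξ, hξ, ?_⟩
  have h1 : inner ℝ b (g 1) = 1 := by
    simp only [hg, one_smul, h.map_point, real_inner_self_eq_norm_sq, h.norm_value, one_pow]
  have hpos : 0 < 1 - r := by linarith [hr.2]
  have h2 := h.one_sub_inner_ge hr
  have h3 : (1 + r) / 2 * kalajConstant n ≤ inner ℝ b (deriv g ξ) := by
    rw [hslope, h1, le_div_iff₀ hpos]
    calc _ = (1 - r ^ 2) / 2 * kalajConstant n := by ring
      _ ≤ _ := h2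
  calc _ ≤ _ := h3
    _ ≤ ‖b‖ * ‖deriv g ξ‖ := real_inner_le_norm _ _
    _ = _ := by rw [h.norm_value, one_mul]

theorem IsBoundarySchwarzMap.le_limsup_enorm_deriv (h : IsBoundarySchwarzMap f a b) :
    ENNReal.ofReal (kalajConstant n) ≤
      limsup (fun r : ℝ => ‖deriv (fun t : ℝ => f (t • a)) r‖ₑ) (𝓝[<] (1 : ℝ)) := by
  refine le_of_forall_lt fun c hc => ?_
  obtain ⟨c', hcc', hc'⟩ := exists_between hc
  refine hcc'.trans_le (le_limsup_of_frequently_le ?_)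
  have hc'top : c' ≠ ⊤ := hc'.ne_top
  have hlt : c'.toReal < kalajConstant n := (ENNReal.lt_ofReal_iff_toReal_lt hc'top).1 hc'
  have hev : ∀ᶠ r in 𝓝[<] (1 : ℝ), c'.toReal < (1 + r) / 2 * kalajConstant n := by
    have hcont : Continuous fun r : ℝ => (1 + r) / 2 * kalajConstant n := by fun_prop
    have := (hcont.tendsto 1).mono_left (nhdsWithin_le_nhds (s := Set.Iio 1))
    refine this.eventually (lt_mem_nhds ?_)
    norm_num
    exact hlt
  intro hnot
  obtain ⟨r₀, hr₀, hr₀'⟩ := (mem_nhdsLT_iff_exists_Ioo_subset' (zero_lt_one (α := ℝ))).1 hnot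
  have hmem : Set.Ioo (max r₀ 0) 1 ∈ 𝓝[<] (1 : ℝ) :=
    Ioo_mem_nhdsLT (max_lt hr₀ zero_lt_one)
  obtain ⟨r, hrC, hr⟩ := (hev.and (eventually_mem_set.2 hmem)).exists
  have hr1 := max_lt_iff.1 hr.1
  obtain ⟨ξ, hξ, hle⟩ := h.exists_le_norm_deriv ⟨hr1.2, hr.2⟩
  refine hr₀' ⟨hr1.1.trans hξ.1, hξ.2⟩ ?_
  change c' ≤ ‖deriv (fun t : ℝ => f (t • a)) ξ‖ₑ
  rw [← ofReal_norm]
  exact (ENNReal.le_ofReal_iff_toReal_le hc'top (norm_nonneg _)).2 (hrC.le.trans hle)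

theorem eventually_add_smul_mem_ball {v : EuclideanSpace ℝ (Fin n)} (ha : ‖a‖ = 1)
    (hv : inner ℝ a v < 0) :
    ∀ᶠ t in 𝓝[>] (0 : ℝ), a + t • v ∈ ball (0 : EuclideanSpace ℝ (Fin n)) 1 := by
  have hδ : 0 < -2 * inner ℝ a v / (‖v‖ ^ 2 + 1) := div_pos (by linarith) (by positivity)
  filter_upwards [Ioo_mem_nhdsGT hδ] with t ht
  have h1 := (lt_div_iff₀ (by positivity)).1 ht.2
  rw [mem_ball_zero_iff, ← sq_lt_one_iff₀ (norm_nonneg _), norm_add_sq_real, ha, norm_smul,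
    inner_smul_right, Real.norm_of_nonneg ht.1.le]
  nlinarith [ht.1]

/-- Derivatives of `⟪b, f⟫` at `a` in inward directions are computed from inside the ball. -/
theorem IsBoundarySchwarzMap.tendsto_slope (h : IsBoundarySchwarzMap f a b)
    {Df : EuclideanSpace ℝ (Fin n) →L[ℝ] H} (hDf : HasFDerivWithinAt f Df (ball 0 1) a)
    {v : EuclideanSpace ℝ (Fin n)} (hv : inner ℝ a v < 0) :
    Tendsto (fun t : ℝ => (inner ℝ b (f (a + t • v)) - 1) / t) (𝓝[>] 0)
      (𝓝 (inner ℝ b (Df v))) := by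
  set s : Set ℝ := {t | a + t • v ∈ ball (0 : EuclideanSpace ℝ (Fin n)) 1} with hs
  have hc : HasDerivWithinAt (fun t : ℝ => a + t • v) v s 0 := by
    simpa using (((hasDerivAt_id (0 : ℝ)).smul_const v).const_add a).hasDerivWithinAt
  have hDf' : HasFDerivWithinAt f Df (ball 0 1) ((fun t : ℝ => a + t • v) 0) := by simpa using hDf
  have hcomp := hDf'.comp_hasDerivWithinAt (0 : ℝ) hc fun t ht => ht
  have hu : HasDerivWithinAt (fun t : ℝ => inner ℝ b (f (a + t • v))) (inner ℝ b (Df v)) s 0 := by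
    simpa using (hasDerivWithinAt_const (0 : ℝ) s b).inner ℝ hcomp
  have h0 : (0 : ℝ) ∉ s := by simp [hs, h.norm_point]
  have hlim := (hasDerivWithinAt_iff_tendsto_slope' h0).1 hu
  have hle : 𝓝[>] (0 : ℝ) ≤ 𝓝[s] 0 :=
    nhdsWithin_le_iff.2 (eventually_add_smul_mem_ball h.norm_point hv)
  refine (hlim.mono_left hle).congr fun t => ?_
  rw [slope_def_field]
  simp [h.map_point, h.norm_value]

variable [CompleteSpace H]

theorem IsBoundarySchwarzMap.exists_adjoint_eq_smul (h : IsBoundarySchwarzMap f a b)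
    {Df : EuclideanSpace ℝ (Fin n) →L[ℝ] H} (hDf : HasFDerivWithinAt f Df (ball 0 1) a) :
    ∃ lam : ℝ, ContinuousLinearMap.adjoint Df b = lam • a ∧ kalajConstant n ≤ lam := by
  set p := ContinuousLinearMap.adjoint Df b
  have hp : ∀ v, inner ℝ b (Df v) = inner ℝ p v := fun v =>
    (ContinuousLinearMap.adjoint_inner_left Df v b).symm
  have haa : inner ℝ a a = 1 := by rw [real_inner_self_eq_norm_sq, h.norm_point, one_pow]
  -- `⟪b, f⟫` is at most its value `1` at `a`, so it does not increase in inward directions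
  have hneg : ∀ v, inner ℝ a v < 0 → inner ℝ p v ≤ 0 := by
    intro v hv
    rw [← hp]
    refine le_of_tendsto (h.tendsto_slope hDf hv) ?_
    filter_upwards [eventually_add_smul_mem_ball h.norm_point hv, self_mem_nhdsWithin] with t ht ht0
    exact div_nonpos_of_nonpos_of_nonneg
      (by linarith [(abs_lt.1 (h.abs_inner_lt ht)).2]) (le_of_lt ht0)
  refine ⟨inner ℝ p a, ?_, ?_⟩
  · set q := p - (inner ℝ p a) • a with hq
    have hqa : inner ℝ a q = 0 := by
      rw [hq, inner_sub_right, inner_smul_right, haa, real_inner_comm]; ring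
    have hpq : inner ℝ p q = ‖q‖ ^ 2 := by
      rw [← real_inner_self_eq_norm_sq]
      nth_rewrite 2 [hq]
      rw [inner_sub_left, inner_smul_left, hqa]
      simp
    -- `q` is tangential; its inward perturbations `q - ε • a` are tested
    have hε : ∀ ε > 0, ‖q‖ ^ 2 - ε * inner ℝ p a ≤ 0 := by
      intro ε hε
      have := hneg (q - ε • a) (by
        rw [inner_sub_right, inner_smul_right, haa, hqa]; linarith)
      rwa [inner_sub_right, inner_smul_right, hpq] at this
    have hlim : Tendsto (fun ε : ℝ => ‖q‖ ^ 2 - ε * inner ℝ p a) (𝓝[>] 0) (𝓝 (‖q‖ ^ 2)) := by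
      have hc : Continuous fun ε : ℝ => ‖q‖ ^ 2 - ε * inner ℝ p a := by fun_prop
      simpa using (hc.tendsto 0).mono_left (nhdsWithin_le_nhds (s := Set.Ioi 0))
    have h0 : ‖q‖ ^ 2 ≤ 0 := le_of_tendsto hlim (by
      filter_upwards [self_mem_nhdsWithin] with ε hε' using hε ε hε')
    have : q = 0 := norm_eq_zero.1 (pow_eq_zero_iff two_ne_zero |>.1
      (le_antisymm h0 (by positivity)))
    exact sub_eq_zero.1 this
  · have hv : inner ℝ a (-a) < 0 := by rw [inner_neg_right, haa]; norm_num
    have hlim := (h.tendsto_slope hDf hv).neg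
    rw [hp, inner_neg_right, neg_neg] at hlim
    have hlim2 : Tendsto (fun t : ℝ => (2 - t) / 2 * kalajConstant n) (𝓝[>] 0)
        (𝓝 (kalajConstant n)) := by
      have hc : Continuous fun t : ℝ => (2 - t) / 2 * kalajConstant n := by fun_prop
      simpa using (hc.tendsto 0).mono_left (nhdsWithin_le_nhds (s := Set.Ioi 0))
    refine le_of_tendsto_of_tendsto hlim2 hlim ?_
    filter_upwards [Ioo_mem_nhdsGT (zero_lt_one (α := ℝ))] with t ht
    have h1 := h.one_sub_inner_ge (ρ := 1 - t) ⟨by linarith [ht.2], by linarith [ht.1]⟩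
    have h2 : a + t • -a = (1 - t) • a := by rw [sub_smul, one_smul, smul_neg, sub_eq_add_neg]
    rw [h2, ← neg_div, le_div_iff₀ ht.1]
    calc _ = (1 - (1 - t) ^ 2) / 2 * kalajConstant n := by ring
      _ ≤ _ := h1
      _ = _ := by ring

end BoundarySchwarz

/-! ### The extremal map in the plane -/

section Sharpness

theorem InnerProductSpace.HarmonicAt.comp_linearIsometryEquiv {E E' : Type*} [NormedAddCommGroup E]
    [InnerProductSpace ℝ E] [FiniteDimensional ℝ E] [NormedAddCommGroup E']
    [InnerProductSpace ℝ E'] [FiniteDimensional ℝ E'] (T : E ≃ₗᵢ[ℝ] E') {u : E' → ℝ} {x : E}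
    (hu : HarmonicAt u (T x)) : HarmonicAt (u ∘ T) x := by
  have hcd : ∀ y, HarmonicAt u (T y) → ContDiffAt ℝ 2 (u ∘ T) y := fun y hy =>
    hy.1.comp y T.contDiff.contDiffAt
  have hfd : ∀ (W : E' → ℝ) (z v : E), fderiv ℝ (W ∘ T) z v = fderiv ℝ W (T z) (T v) :=
    fun W z v => by
      have := T.toContinuousLinearEquiv.comp_right_fderiv (f := W) (x := z)
      exact DFunLike.congr_fun this v
  refine ⟨hcd x hu, ?_⟩
  filter_upwards [T.continuous.continuousAt.eventually hu.eventually] with y hy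
  set e := stdOrthonormalBasis ℝ E
  have h2 := laplacian_eq_sum_fderiv (e.map T) hy.1
  rw [hy.2.self_of_nhds] at h2
  rw [laplacian_eq_sum_fderiv e (hcd y hy)]
  have : ∀ v : E, fderiv ℝ (fun z => fderiv ℝ (u ∘ T) z v) y v =
      fderiv ℝ (fun z => fderiv ℝ u z (T v)) (T y) (T v) := by
    intro v
    rw [← hfd (fun z => fderiv ℝ u z (T v)) y v]
    congr 2
    ext z
    exact hfd u z v
  simp_rw [this]
  simpa using h2.symm

/-- A holomorphic map of the unit disc onto the strip `|Im| < π / 2`, whose imaginary part is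
harmonic with boundary values `π / 2` and `-π / 2` on the right and left half circles. -/
noncomputable def discToStrip (z : ℂ) : ℂ :=
  Complex.log ((1 + Complex.I * z) / (1 - Complex.I * z))

theorem one_sub_I_mul_ne_zero {z : ℂ} (hz : ‖z‖ < 1) : 1 - Complex.I * z ≠ 0 := by
  intro h
  have h1 : ‖Complex.I * z‖ = 1 := by rw [← sub_eq_zero.1 h, norm_one]
  rw [norm_mul, Complex.norm_I, one_mul] at h1
  exact hz.ne h1

theorem cayley_re_pos {z : ℂ} (hz : ‖z‖ < 1) :
    0 < ((1 + Complex.I * z) / (1 - Complex.I * z)).re := by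
  have h0 := Complex.normSq_pos.2 (one_sub_I_mul_ne_zero hz)
  have h1 : z.re ^ 2 + z.im ^ 2 < 1 := by
    have h2 := Complex.normSq_apply z
    rw [Complex.normSq_eq_norm_sq] at h2
    nlinarith [norm_nonneg z]
  rw [Complex.div_re, ← add_div]
  refine div_pos ?_ h0
  simp
  nlinarith

theorem analyticAt_discToStrip {z : ℂ} (h0 : 1 - Complex.I * z ≠ 0)
    (hs : (1 + Complex.I * z) / (1 - Complex.I * z) ∈ Complex.slitPlane) :
    AnalyticAt ℂ discToStrip z := by
  have h1 : AnalyticAt ℂ (fun z => 1 + Complex.I * z) z := by fun_prop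
  have h2 : AnalyticAt ℂ (fun z => 1 - Complex.I * z) z := by fun_prop
  exact (h1.div h2 h0).clog hs

theorem one_add_I_div_one_sub_I : (1 + Complex.I * 1) / (1 - Complex.I * 1) = Complex.I := by
  have h : (1 - Complex.I * 1) ≠ 0 := by
    intro h
    have := congrArg Complex.re h
    simp at this
  rw [div_eq_iff h]
  linear_combination Complex.I_mul_I

theorem hasDerivAt_discToStrip_one : HasDerivAt discToStrip Complex.I 1 := by
  have h0 : (1 - Complex.I * 1) ≠ 0 := by
    intro h
    have := congrArg Complex.re h
    simp at this
  have h1 : HasDerivAt (fun z : ℂ => 1 + Complex.I * z) Complex.I 1 := by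
    simpa using ((hasDerivAt_id (1 : ℂ)).const_mul Complex.I).const_add 1
  have h2 : HasDerivAt (fun z : ℂ => 1 - Complex.I * z) (-Complex.I) 1 := by
    simpa using ((hasDerivAt_id (1 : ℂ)).const_mul Complex.I).const_sub 1
  have h3 := (h1.div h2 h0).clog (by
    simp only [Pi.div_apply]
    rw [one_add_I_div_one_sub_I]
    simp [Complex.mem_slitPlane_iff])
  convert! h3 using 1
  simp only [Pi.div_apply]
  rw [one_add_I_div_one_sub_I]
  have hI := Complex.I_ne_zero
  rw [eq_div_iff hI, eq_div_iff (pow_ne_zero 2 h0)]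
  linear_combination (Complex.I * Complex.I - 2 * Complex.I) * Complex.I_mul_I

/-- The extremal map is `(2 / π) Im (discToStrip z) • b`, in complex coordinates with `a = 1`. -/
theorem exists_isBoundarySchwarzMap_adjoint_eq {H : Type*} [NormedAddCommGroup H]
    [InnerProductSpace ℝ H] [CompleteSpace H] {a : EuclideanSpace ℝ (Fin 2)} {b : H}
    (ha : ‖a‖ = 1) (hb : ‖b‖ = 1) :
    ∃ (f : EuclideanSpace ℝ (Fin 2) → H) (Df : EuclideanSpace ℝ (Fin 2) →L[ℝ] H),
      IsBoundarySchwarzMap f a b ∧ HasFDerivWithinAt f Df (ball 0 1) a ∧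
        ContinuousLinearMap.adjoint Df b = (2 / Real.pi) • a := by
  -- identify the plane with `ℂ` so that `a` becomes `1`
  set T₀ : EuclideanSpace ℝ (Fin 2) ≃ₗᵢ[ℝ] ℂ := Complex.orthonormalBasisOneI.repr.symm
  have hn : ‖T₀ a‖ = ‖(1 : ℂ)‖ := by rw [T₀.norm_map, ha, norm_one]
  set T : EuclideanSpace ℝ (Fin 2) ≃ₗᵢ[ℝ] ℂ :=
    T₀.trans (ℝ ∙ (T₀ a - 1))ᗮ.reflection
  have hT : T a = 1 := Submodule.reflection_sub hn
  have hre : ∀ v, (T v).re = inner ℝ a v := fun v => by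
    rw [← T.inner_map_map, hT, Complex.inner]
    simp
  have hpi := Real.pi_pos
  set L : ℝ →L[ℝ] H := ContinuousLinearMap.toSpanSingleton ℝ b
  set u : EuclideanSpace ℝ (Fin 2) → ℝ :=
    (2 / Real.pi) • ((fun z => (discToStrip z).im) ∘ T) with hu
  have huval : ∀ x, u x = 2 / Real.pi * (discToStrip (T x)).im := fun x => rfl
  have hua : u a = 1 := by
    rw [huval, hT, discToStrip, one_add_I_div_one_sub_I, Complex.log_I]
    simp
  have hfa : (L ∘ u) a = b := by simp [L, hua]
  have hTb : ∀ x ∈ ball (0 : EuclideanSpace ℝ (Fin 2)) 1, ‖T x‖ < 1 := fun x hx => by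
    rw [T.norm_map]; simpa using hx
  have hDu : HasFDerivAt u ((2 / Real.pi) • innerSL ℝ a) a := by
    have h1 : HasFDerivAt discToStrip
        ((ContinuousLinearMap.toSpanSingleton ℂ Complex.I).restrictScalars ℝ) (T a) := by
      rw [hT]
      exact hasDerivAt_discToStrip_one.hasFDerivAt.restrictScalars ℝ
    have h2 := ((Complex.imCLM.hasFDerivAt.comp (T a) h1).comp a
      T.toContinuousLinearEquiv.hasFDerivAt).const_smul (2 / Real.pi)
    convert! h2 using 1
    ext v
    simp [← hre]
  have hDf : HasFDerivAt (L ∘ u) (L ∘L ((2 / Real.pi) • innerSL ℝ a)) a :=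
    L.hasFDerivAt.comp a hDu
  refine ⟨L ∘ u, L ∘L ((2 / Real.pi) • innerSL ℝ a), ⟨?_, ?_, ?_, ha, hb, hfa, ?_⟩,
    hDf.hasFDerivWithinAt, ?_⟩
  · intro x hx
    refine HarmonicAt.comp_CLM ?_ L
    refine HarmonicAt.const_smul (HarmonicAt.comp_linearIsometryEquiv T ?_)
    exact (analyticAt_discToStrip (one_sub_I_mul_ne_zero (hTb x hx))
      (Or.inl (cayley_re_pos (hTb x hx)))).harmonicAt_im
  · intro x hx
    have harg : |(discToStrip (T x)).im| < Real.pi / 2 := by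
      rw [discToStrip, Complex.log_im]
      exact Complex.abs_arg_lt_pi_div_two_iff.2 (Or.inl (cayley_re_pos (hTb x hx)))
    have hux : |u x| < 1 := by
      rw [huval, abs_mul, abs_of_pos (by positivity : 0 < 2 / Real.pi)]
      calc _ < 2 / Real.pi * (Real.pi / 2) := by gcongr
        _ = 1 := by field_simp
    simpa [L, norm_smul, hb] using hux
  · simp [L, huval, discToStrip]
  · exact hDf.continuousAt.continuousWithinAt
  · refine ext_inner_right ℝ fun v => ?_
    rw [ContinuousLinearMap.adjoint_inner_left, inner_smul_left]
    simp [L, inner_smul_right, hb]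

end Sharpness

/-! ### The boundary Schwarz lemma with its sharp planar constant -/

theorem mainTheorem3 {H : Type*} [NormedAddCommGroup H] [InnerProductSpace ℝ H]
    [CompleteSpace H] :
    (∀ (n : ℕ) (f : EuclideanSpace ℝ (Fin n) → H) (a : EuclideanSpace ℝ (Fin n)) (b : H),
      IsBoundarySchwarzMap f a b →
        ENNReal.ofReal (kalajConstant n) ≤
            limsup (fun r : ℝ => ‖deriv (fun t : ℝ => f (t • a)) r‖ₑ) (𝓝[<] (1 : ℝ)) ∧
          ∀ Df : EuclideanSpace ℝ (Fin n) →L[ℝ] H, HasFDerivWithinAt f Df (ball 0 1) a →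
            ∃ lam : ℝ, 0 < lam ∧ ContinuousLinearMap.adjoint Df b = lam • a ∧
              kalajConstant n ≤ lam ∧ (n = 2 → 2 / Real.pi ≤ lam)) ∧
    (∀ (a : EuclideanSpace ℝ (Fin 2)) (b : H), ‖a‖ = 1 → ‖b‖ = 1 →
      ∃ (f : EuclideanSpace ℝ (Fin 2) → H) (Df : EuclideanSpace ℝ (Fin 2) →L[ℝ] H),
        IsBoundarySchwarzMap f a b ∧ HasFDerivWithinAt f Df (ball 0 1) a ∧
          ContinuousLinearMap.adjoint Df b = (2 / Real.pi) • a) := by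
  refine ⟨fun n f a b h => ⟨h.le_limsup_enorm_deriv, fun Df hDf => ?_⟩,
    fun a b ha hb => exists_isBoundarySchwarzMap_adjoint_eq ha hb⟩
  obtain ⟨lam, hadj, hle⟩ := h.exists_adjoint_eq_smul hDf
  refine ⟨lam, h.kalajConstant_pos.trans_le hle, hadj, hle, ?_⟩
  rintro rfl
  rwa [kalajConstant_two] at hle
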